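/- Let $\mathcal H$ be a nonzero finite-dimensional complex Hilbert space; all Hilbert spaces below are finite-dimensional. A von Neumann algebra on $\mathcal H$ is a unital $*$-subalgebra of $\mathcal L(\mathcal H)$; write $\mathrm{vN}(\mathcal H)$ for the set of these, ordered by inclusion, and $\mathcal A'$ for the commutant of $\mathcal A$ in $\mathcal L(\mathcal H)$. A splitting map on $\mathcal H$ is an isometry $\chi:\mathcal H\to\mathcal H_L^\chi\otimes\mathcal H_R^\chi$. For splitting maps $\zeta,\chi$ on $\mathcal H$, $\zeta$ is comprehended in $\chi$, written $\zeta\sqsubseteq\chi$, if there are a Hilbert space $\mathcal H_M$ and isometries $f:\mathcal H_R^\zeta\to\mathcal H_M\otimes\mathcal H_R^\chi$ and $g:\mathcal H_L^\chi\to\mathcal H_L^\zeta\otimes\mathcal H_M$ with $(\mathbb 1\otimes f)\zeta=(g\otimes\mathbb 1)\chi$; this is a preorder. The algebra $\mathrm{StLoc}_L(\chi)$ of strictly (left) $\chi$-local operators consists of the $A\in\mathcal L(\mathcal H)$ for which some $B\in\mathcal L(\mathcal H_L^\chi)$ satisfies $A\chi^\dagger=\chi^\dagger(B\otimes\mathbb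 1)$ and $\chi A=(B\otimes\mathbb 1)\chi$; $\mathrm{StLoc}_R(\chi)$ is defined in the same way with $\mathbb 1\otimes B$, $B\in\mathcal L(\mathcal H_R^\chi)$. Both are von Neumann algebras on $\mathcal H$. The splitting map $\chi$ is balanced if $\mathrm{StLoc}_R(\chi)=\mathrm{StLoc}_L(\chi)'$. A canonical splitting map for $\mathcal A\in\mathrm{vN}(\mathcal H)$ is a composite $\mathcal H\xrightarrow{U}\bigoplus_i\mathcal H_L^i\otimes\mathcal H_R^i\hookrightarrow(\bigoplus_i\mathcal H_L^i)\otimes(\bigoplus_i\mathcal H_R^i)$, where $i$ ranges over a finite set, the $\mathcal H_L^i,\mathcal H_R^i$ are nonzero Hilbert spaces, and $U$ is a unitary with $U\mathcal A U^\dagger=\bigoplus_i\mathcal L(\mathcal H_L^i)\otimes\mathbb 1_{\mathcal H_R^i}$. For a class $\mathcal C$ of splitting maps on $\mathcal H$, preorder-preserving maps $F:\mathrm{vN}(\mathcal H)\to\mathcal C$ and $G:\mathcal C\to\mathrm{vN}(\mathcal H)$ yield an equivalence of preorders if $\mathcal A\subseteq GF(\mathcal A)\subseteq\mathcal A$ for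 all $\mathcal A\in\mathrm{vN}(\mathcal H)$ and $\chi\sqsubseteq FG(\chi)\sqsubseteq\chi$ for all $\chi\in\mathcal C$. **Theorem.** Every $\mathcal A\in\mathrm{vN}(\mathcal H)$ has a canonical splitting map. Let $F$ be any map sending each $\mathcal A\in\mathrm{vN}(\mathcal H)$ to a canonical splitting map for $\mathcal A$, and let $G=\mathrm{StLoc}_L$. Then $F$ is preorder-preserving from $(\mathrm{vN}(\mathcal H),\subseteq)$ to the splitting maps on $\mathcal H$ with $\sqsubseteq$, and $G$ is preorder-preserving in the other direction. Moreover, among the classes $\mathcal C$ of splitting maps on $\mathcal H$ such that $F$ takes values in $\mathcal C$ and $F$, $G|_{\mathcal C}$ yield an equivalence of preorders between $\mathrm{vN}(\mathcal H)$ and $\mathcal C$, there is a largest one, namely the class of balanced splitting maps. -/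

import Mathlib

open scoped TensorProduct

universe u

section

/-- A von Neumann algebra on a finite-dimensional Hilbert space `H`: a unital *-subalgebra of the
algebra `L(H)` of operators on `H` (the involution is the Hilbert space adjoint), ordered by
inclusion. -/
abbrev VNAlg (H : Type u) [NormedAddCommGroup H] [InnerProductSpace ℂ H]
    [FiniteDimensional ℂ H] : Type u :=
  StarSubalgebra ℂ (Module.End ℂ H)

/-- A splitting map on `H`: an isometry `H → L ⊗ R` with `L`, `R` finite-dimensional Hilbert
spaces. -/
structure SplittingMap (H : Type u) [NormedAddCommGroup H] [InnerProductSpace ℂ H] where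
  L : Type u
  R : Type u
  [normedL : NormedAddCommGroup L]
  [innerL : InnerProductSpace ℂ L]
  [finiteL : FiniteDimensional ℂ L]
  [normedR : NormedAddCommGroup R]
  [innerR : InnerProductSpace ℂ R]
  [finiteR : FiniteDimensional ℂ R]
  toIsometry : H →ₗᵢ[ℂ] L ⊗[ℂ] R

attribute [instance] SplittingMap.normedL SplittingMap.innerL SplittingMap.finiteL
  SplittingMap.normedR SplittingMap.innerR SplittingMap.finiteR

namespace SplittingMap

variable {H : Type u} [NormedAddCommGroup H] [InnerProductSpace ℂ H]

/-- The splitting map as a linear map. -/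
noncomputable def toLin (χ : SplittingMap H) : H →ₗ[ℂ] χ.L ⊗[ℂ] χ.R := χ.toIsometry.toLinearMap

/-- `ζ` is comprehended in `χ`: there are a Hilbert space `M` and isometries
`f : R_ζ → M ⊗ R_χ` and `g : L_χ → L_ζ ⊗ M` with `(1 ⊗ f) ζ = (g ⊗ 1) χ`. -/
def Comprehended (ζ χ : SplittingMap H) : Prop :=
  ∃ (M : Type u) (_ : NormedAddCommGroup M) (_ : InnerProductSpace ℂ M)
    (_ : FiniteDimensional ℂ M)
    (f : ζ.R →ₗᵢ[ℂ] M ⊗[ℂ] χ.R) (g : χ.L →ₗᵢ[ℂ] ζ.L ⊗[ℂ] M),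
    f.toLinearMap.lTensor ζ.L ∘ₗ ζ.toLin =
      (TensorProduct.assoc ℂ ζ.L M χ.R).toLinearMap ∘ₗ
        g.toLinearMap.rTensor χ.R ∘ₗ χ.toLin

theorem Comprehended.refl (χ : SplittingMap H) : χ.Comprehended χ := by
  let e : EuclideanSpace ℂ PUnit.{u + 1} := EuclideanSpace.single PUnit.unit 1
  have he : ‖e‖ = 1 := by simp [e]
  refine ⟨EuclideanSpace ℂ PUnit.{u + 1}, inferInstance, inferInstance, inferInstance,
    ⟨TensorProduct.mk ℂ _ χ.R e, fun x => by simp [he]⟩,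
    ⟨(TensorProduct.mk ℂ χ.L _).flip e, fun x => by simp [he]⟩, ?_⟩
  rw [← LinearMap.comp_assoc]
  congr 1
  exact TensorProduct.ext' fun x y => rfl

theorem comprehended_aux₁ {X Z M R N S : Type u}
    [AddCommGroup X] [Module ℂ X] [AddCommGroup Z] [Module ℂ Z] [AddCommGroup M] [Module ℂ M]
    [AddCommGroup R] [Module ℂ R] [AddCommGroup N] [Module ℂ N] [AddCommGroup S] [Module ℂ S]
    (f : R →ₗ[ℂ] N ⊗[ℂ] S) (g : Z →ₗ[ℂ] X ⊗[ℂ] M) (z : Z ⊗[ℂ] R) :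
    (f.lTensor M).lTensor X (TensorProduct.assoc ℂ X M R (g.rTensor R z)) =
      TensorProduct.assoc ℂ X M (N ⊗[ℂ] S) (g.rTensor (N ⊗[ℂ] S) (f.lTensor Z z)) := by
  induction z using TensorProduct.induction_on with
  | zero => simp
  | add a b ha hb => simp only [map_add, ha, hb]
  | tmul a b =>
    simp only [LinearMap.rTensor_tmul, LinearMap.lTensor_tmul]
    induction g a using TensorProduct.induction_on with
    | zero => simp
    | add c d hc hd => simp only [TensorProduct.add_tmul, map_add, hc, hd]
    | tmul c d => simp

theorem comprehended_aux₂ {X Z M N S : Type u}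
    [AddCommGroup X] [Module ℂ X] [AddCommGroup Z] [Module ℂ Z] [AddCommGroup M] [Module ℂ M]
    [AddCommGroup N] [Module ℂ N] [AddCommGroup S] [Module ℂ S]
    (g : Z →ₗ[ℂ] X ⊗[ℂ] M) (w : (Z ⊗[ℂ] N) ⊗[ℂ] S) :
    (TensorProduct.assoc ℂ M N S).symm.toLinearMap.lTensor X
        (TensorProduct.assoc ℂ X M (N ⊗[ℂ] S)
          (g.rTensor (N ⊗[ℂ] S) (TensorProduct.assoc ℂ Z N S w))) =
      TensorProduct.assoc ℂ X (M ⊗[ℂ] N) S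
        (((TensorProduct.assoc ℂ X M N).toLinearMap ∘ₗ g.rTensor N).rTensor S w) := by
  induction w using TensorProduct.induction_on with
  | zero => simp
  | add a b ha hb => simp only [map_add, ha, hb]
  | tmul a s =>
    induction a using TensorProduct.induction_on with
    | zero => simp
    | add a b ha hb => simp only [TensorProduct.add_tmul, map_add, ha, hb]
    | tmul z n =>
      simp only [LinearMap.rTensor_tmul, TensorProduct.assoc_tmul, LinearMap.comp_apply]
      induction g z using TensorProduct.induction_on with
      | zero => simp
      | add c d hc hd => simp only [TensorProduct.add_tmul, map_add, hc, hd]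
      | tmul c d => simp

theorem Comprehended.trans {ξ ζ χ : SplittingMap H} (h₁ : ξ.Comprehended ζ)
    (h₂ : ζ.Comprehended χ) : ξ.Comprehended χ := by
  obtain ⟨M, _, _, _, f, g, h⟩ := h₁
  obtain ⟨N, _, _, _, f', g', h'⟩ := h₂
  refine ⟨M ⊗[ℂ] N, inferInstance, inferInstance, inferInstance,
    (TensorProduct.assocIsometry ℂ M N χ.R).symm.toLinearIsometry.comp
      ((f'.lTensor M).comp f),
    (TensorProduct.assocIsometry ℂ ξ.L M N).toLinearIsometry.comp
      ((g.rTensor N).comp g'), ?_⟩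
  ext x
  have hx := LinearMap.congr_fun h x
  have hx' := LinearMap.congr_fun h' x
  simp only [LinearMap.comp_apply, LinearEquiv.coe_coe] at hx hx'
  have e₁ := comprehended_aux₁ f'.toLinearMap g.toLinearMap (ζ.toLin x)
  rw [← hx, hx'] at e₁
  have e₂ := comprehended_aux₂ (N := N) g.toLinearMap (g'.toLinearMap.rTensor χ.R (χ.toLin x))
  rw [← e₁] at e₂
  refine Eq.trans ?_ (e₂.trans ?_)
  · rw [← LinearMap.lTensor_comp_apply, ← LinearMap.lTensor_comp_apply]
    rfl
  · rw [← LinearMap.rTensor_comp_apply]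
    rfl

instance : Preorder (SplittingMap H) where
  le := Comprehended
  le_refl := Comprehended.refl
  le_trans _ _ _ := Comprehended.trans

theorem le_iff {ζ χ : SplittingMap H} : ζ ≤ χ ↔ ζ.Comprehended χ := Iff.rfl

variable [FiniteDimensional ℂ H]

/-- The adjoint `χ†` of a splitting map. -/
noncomputable def adj (χ : SplittingMap H) : χ.L ⊗[ℂ] χ.R →ₗ[ℂ] H := LinearMap.adjoint χ.toLin

/-- The von Neumann algebra of strictly (left) `χ`-local operators: those `A` for which there is
an operator `B` on `L` with `A χ† = χ† (B ⊗ 1)` and `χ A = (B ⊗ 1) χ`. -/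
noncomputable def stLocL (χ : SplittingMap H) : VNAlg H where
  carrier := {A | ∃ B : Module.End ℂ χ.L,
    A ∘ₗ χ.adj = χ.adj ∘ₗ B.rTensor χ.R ∧ χ.toLin ∘ₗ A = B.rTensor χ.R ∘ₗ χ.toLin}
  mul_mem' := by
    rintro A A' ⟨B, h₁, h₂⟩ ⟨B', h₁', h₂'⟩
    refine ⟨B * B', ?_, ?_⟩
    · rw [Module.End.mul_eq_comp, Module.End.mul_eq_comp, LinearMap.comp_assoc, h₁',
        ← LinearMap.comp_assoc, h₁, LinearMap.rTensor_comp, LinearMap.comp_assoc]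
    · rw [Module.End.mul_eq_comp, Module.End.mul_eq_comp, ← LinearMap.comp_assoc, h₂,
        LinearMap.comp_assoc, h₂', LinearMap.rTensor_comp, LinearMap.comp_assoc]
  add_mem' := by
    rintro A A' ⟨B, h₁, h₂⟩ ⟨B', h₁', h₂'⟩
    refine ⟨B + B', ?_, ?_⟩
    · rw [LinearMap.rTensor_add, LinearMap.add_comp, LinearMap.comp_add, h₁, h₁']
    · rw [LinearMap.rTensor_add, LinearMap.add_comp, LinearMap.comp_add, h₂, h₂']
  algebraMap_mem' := by
    intro c
    refine ⟨algebraMap ℂ _ c, ?_, ?_⟩ <;> ext x <;>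
      simp [Module.algebraMap_end_eq_smul_id, LinearMap.rTensor_smul]
  star_mem' := by
    rintro A ⟨B, h₁, h₂⟩
    refine ⟨star B, ?_, ?_⟩
    · have := congrArg LinearMap.adjoint h₂
      simpa [LinearMap.star_eq_adjoint, LinearMap.adjoint_comp, adj] using this
    · have := congrArg LinearMap.adjoint h₁
      simpa [LinearMap.star_eq_adjoint, LinearMap.adjoint_comp, adj] using this

/-- The von Neumann algebra of strictly right `χ`-local operators. -/
noncomputable def stLocR (χ : SplittingMap H) : VNAlg H where
  carrier := {A | ∃ B : Module.End ℂ χ.R,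
    A ∘ₗ χ.adj = χ.adj ∘ₗ B.lTensor χ.L ∧ χ.toLin ∘ₗ A = B.lTensor χ.L ∘ₗ χ.toLin}
  mul_mem' := by
    rintro A A' ⟨B, h₁, h₂⟩ ⟨B', h₁', h₂'⟩
    refine ⟨B * B', ?_, ?_⟩
    · rw [Module.End.mul_eq_comp, Module.End.mul_eq_comp, LinearMap.comp_assoc, h₁',
        ← LinearMap.comp_assoc, h₁, LinearMap.lTensor_comp, LinearMap.comp_assoc]
    · rw [Module.End.mul_eq_comp, Module.End.mul_eq_comp, ← LinearMap.comp_assoc, h₂,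
        LinearMap.comp_assoc, h₂', LinearMap.lTensor_comp, LinearMap.comp_assoc]
  add_mem' := by
    rintro A A' ⟨B, h₁, h₂⟩ ⟨B', h₁', h₂'⟩
    refine ⟨B + B', ?_, ?_⟩
    · rw [LinearMap.lTensor_add, LinearMap.add_comp, LinearMap.comp_add, h₁, h₁']
    · rw [LinearMap.lTensor_add, LinearMap.add_comp, LinearMap.comp_add, h₂, h₂']
  algebraMap_mem' := by
    intro c
    refine ⟨algebraMap ℂ _ c, ?_, ?_⟩ <;> ext x <;>
      simp [Module.algebraMap_end_eq_smul_id, LinearMap.lTensor_smul]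
  star_mem' := by
    rintro A ⟨B, h₁, h₂⟩
    refine ⟨star B, ?_, ?_⟩
    · have := congrArg LinearMap.adjoint h₂
      simpa [LinearMap.star_eq_adjoint, LinearMap.adjoint_comp, adj] using this
    · have := congrArg LinearMap.adjoint h₁
      simpa [LinearMap.star_eq_adjoint, LinearMap.adjoint_comp, adj] using this

/-- A splitting map is balanced if its strictly right local operators are exactly the commutant
of its strictly left local ones. -/
def IsBalanced (χ : SplittingMap H) : Prop :=
  (χ.stLocR : Set (Module.End ℂ H)) = Set.centralizer (χ.stLocL : Set (Module.End ℂ H))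

end SplittingMap

section Embedding

variable {ι : Type u} [Fintype ι] (L R : ι → Type u)
  [∀ i, NormedAddCommGroup (L i)] [∀ i, InnerProductSpace ℂ (L i)]
  [∀ i, NormedAddCommGroup (R i)] [∀ i, InnerProductSpace ℂ (R i)]

open scoped Classical in
/-- The inclusion of the `i`-th summand in a finite Hilbert space direct sum. -/
noncomputable def summandInclusion (i : ι) : L i →ₗᵢ[ℂ] PiLp 2 L where
  toFun x := PiLp.single 2 i x
  map_add' _ _ := PiLp.single_add 2 i
  map_smul' c x := by
    rw [← PiLp.toLp_single, Pi.single_smul]; rfl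
  norm_map' x := PiLp.norm_single 2 L i x

theorem inner_summandInclusion_of_ne {i j : ι} (h : i ≠ j) (x : L i) (y : L j) :
    inner ℂ (summandInclusion L i x) (summandInclusion L j y) = 0 := by
  classical
  rw [PiLp.inner_apply]
  refine Finset.sum_eq_zero fun k _ => ?_
  by_cases hk : k = i
  · subst hk
    have : (summandInclusion L j y) k = 0 := PiLp.single_eq_of_ne 2 h y
    rw [this, inner_zero_right]
  · have : (summandInclusion L i x) k = 0 := PiLp.single_eq_of_ne 2 hk x
    rw [this, inner_zero_left]

theorem inner_map_summandInclusion_of_ne {i j : ι} (h : i ≠ j) (x : L i ⊗[ℂ] R i)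
    (y : L j ⊗[ℂ] R j) :
    inner ℂ (TensorProduct.mapIsometry (summandInclusion L i) (summandInclusion R i) x)
      (TensorProduct.mapIsometry (summandInclusion L j) (summandInclusion R j) y) = 0 := by
  induction x using TensorProduct.induction_on with
  | zero => simp
  | add a b ha hb => rw [map_add, inner_add_left, ha, hb, add_zero]
  | tmul a b =>
    induction y using TensorProduct.induction_on with
    | zero => simp
    | add c d hc hd => rw [map_add, inner_add_right, hc, hd, add_zero]
    | tmul c d => simp [inner_summandInclusion_of_ne L h]

/-- The linear map underlying `blockEmbedding`. -/
noncomputable def blockEmbeddingLin :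
    PiLp 2 (fun i => L i ⊗[ℂ] R i) →ₗ[ℂ] PiLp 2 L ⊗[ℂ] PiLp 2 R :=
  ∑ i, (TensorProduct.map (summandInclusion L i).toLinearMap
    (summandInclusion R i).toLinearMap) ∘ₗ PiLp.projₗ 2 (fun i => L i ⊗[ℂ] R i) i

theorem blockEmbeddingLin_apply (x : PiLp 2 (fun i => L i ⊗[ℂ] R i)) :
    blockEmbeddingLin L R x =
      ∑ i, TensorProduct.mapIsometry (summandInclusion L i) (summandInclusion R i) (x i) := by
  rw [blockEmbeddingLin, LinearMap.sum_apply]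
  rfl

theorem inner_blockEmbeddingLin (x y : PiLp 2 (fun i => L i ⊗[ℂ] R i)) :
    inner ℂ (blockEmbeddingLin L R x) (blockEmbeddingLin L R y) = inner ℂ x y := by
  rw [blockEmbeddingLin_apply, blockEmbeddingLin_apply, sum_inner, PiLp.inner_apply]
  refine Finset.sum_congr rfl fun i _ => ?_
  rw [inner_sum, Finset.sum_eq_single i]
  · exact LinearIsometry.inner_map_map _ _ _
  · intro j _ hj
    exact inner_map_summandInclusion_of_ne L R hj.symm _ _
  · intro hi
    exact absurd (Finset.mem_univ i) hi

/-- The canonical isometric embedding `⨁ i, L i ⊗ R i ↪ (⨁ i, L i) ⊗ (⨁ i, R i)`. -/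
noncomputable def blockEmbedding :
    PiLp 2 (fun i => L i ⊗[ℂ] R i) →ₗᵢ[ℂ] PiLp 2 L ⊗[ℂ] PiLp 2 R :=
  (blockEmbeddingLin L R).isometryOfInner (inner_blockEmbeddingLin L R)

end Embedding

/-- A unitary decomposition `U : H ≃ ⨁ i, L i ⊗ R i` of `H` into finitely many blocks, with `L i`
and `R i` nonzero finite-dimensional Hilbert spaces. -/
structure BlockDecomposition (H : Type u) [NormedAddCommGroup H] [InnerProductSpace ℂ H] where
  ι : Type u
  L : ι → Type u
  R : ι → Type u
  [fintype : Fintype ι]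
  [normedL : ∀ i, NormedAddCommGroup (L i)]
  [innerL : ∀ i, InnerProductSpace ℂ (L i)]
  [finiteL : ∀ i, FiniteDimensional ℂ (L i)]
  [nontrivialL : ∀ i, Nontrivial (L i)]
  [normedR : ∀ i, NormedAddCommGroup (R i)]
  [innerR : ∀ i, InnerProductSpace ℂ (R i)]
  [finiteR : ∀ i, FiniteDimensional ℂ (R i)]
  [nontrivialR : ∀ i, Nontrivial (R i)]
  U : H ≃ₗᵢ[ℂ] PiLp 2 (fun i => L i ⊗[ℂ] R i)

attribute [instance] BlockDecomposition.fintype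
  BlockDecomposition.normedL BlockDecomposition.innerL
  BlockDecomposition.finiteL BlockDecomposition.nontrivialL BlockDecomposition.normedR
  BlockDecomposition.innerR BlockDecomposition.finiteR BlockDecomposition.nontrivialR

namespace BlockDecomposition

variable {H : Type u} [NormedAddCommGroup H] [InnerProductSpace ℂ H]

/-- `D.U` is a representation unitary for `A`: `U A U† = ⨁ i, L(L i) ⊗ 1`. That is, `T` belongs to
`A` if and only if `U T = (⨁ i, a i ⊗ 1) U` for some operators `a i` on `L i`. -/
def Represents [FiniteDimensional ℂ H] (D : BlockDecomposition H) (A : VNAlg H) : Prop :=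
  ∀ T : Module.End ℂ H, T ∈ A ↔ ∃ a : ∀ i, Module.End ℂ (D.L i),
    ∀ (x : H) (i : D.ι), D.U (T x) i = (a i).rTensor (D.R i) (D.U x i)

/-- The splitting map `H ≃ ⨁ i, L i ⊗ R i ↪ (⨁ i, L i) ⊗ (⨁ i, R i)`. -/
noncomputable def splittingMap (D : BlockDecomposition H) : SplittingMap H where
  L := PiLp 2 D.L
  R := PiLp 2 D.R
  toIsometry := (blockEmbedding D.L D.R).comp D.U.toLinearIsometry

end BlockDecomposition

/-- `χ` is a canonical splitting map for the von Neumann algebra `A`: it comes from a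
representation unitary for `A`. -/
def IsCanonicalFor {H : Type u} [NormedAddCommGroup H] [InnerProductSpace ℂ H]
    [FiniteDimensional ℂ H] (A : VNAlg H) (χ : SplittingMap H) : Prop :=
  ∃ D : BlockDecomposition H, D.Represents A ∧ χ = D.splittingMap

/-- Two preorder preserving maps `F`, `G` yield an equivalence of preorders. -/
def YieldEquivalence {X Y : Type*} [Preorder X] [Preorder Y] (F : X → Y) (G : Y → X) : Prop :=
  Monotone F ∧ Monotone G ∧ (∀ x, x ≤ G (F x) ∧ G (F x) ≤ x) ∧ ∀ y, y ≤ F (G y) ∧ F (G y) ≤ y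

/-- `F` and `StLoc` yield an equivalence of preorders between the von Neumann algebras on `H`, and
the class `C` of splitting maps on `H` with the preorder induced by comprehension. -/
def YieldEquivalenceOn {H : Type u} [NormedAddCommGroup H] [InnerProductSpace ℂ H]
    [FiniteDimensional ℂ H] (F : VNAlg H → SplittingMap H) (C : Set (SplittingMap H)) : Prop :=
  ∃ hF : ∀ A, F A ∈ C,
    YieldEquivalence (fun A => (⟨F A, hF A⟩ : C)) (fun χ : C => χ.1.stLocL)

end

/-!
Splitting maps on `H` and von Neumann algebras on `H` are compared through one statement: if `ζ` is
a canonical splitting map for `A`, and every operator in `A` is strictly `χ`-local, then `ζ` is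
comprehended in `χ` (`BlockDecomposition.Represents.splittingMap_le`). Neither `χ` being canonical
nor `χ` being balanced is needed.

For its proof, let `U : H ≃ ⨁ i, L i ⊗ R i` be the representation unitary behind `ζ`, `e i k` an
orthonormal basis of `L i` and `u i ∈ L i` a unit vector. The mediating space is `M = L_χ`. The
isometry on `R_ζ = ⨁ i, R i` is `f(r) = χ(U†(⨁ i, u i ⊗ r i))`. The matrix units
`E i k = |u i⟩⟨e i k| ⊗ 1` belong to `A`, so they are implemented by operators `B i k` on `L_χ`, and
`g(m) = ∑ e i k ⊗ B i k m` satisfies `(g ⊗ 1) χ = (1 ⊗ f) ζ`. As `∑ (E i k)† E i k = 1`, this `g` is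
isometric on the left support of `χ`, the only part of `L_χ` that `χ` sees; on the orthogonal
complement it is replaced by `m ↦ e₀ ⊗ m` with a unit vector `e₀`. This is
`SplittingMap.comprehended_of_sum_adjoint_comp`.

Exchanging left and right reverses comprehension, turns left local operators into right local ones
and, by `BlockDecomposition.Represents.flip`, a canonical splitting map for `A` into one for the
commutant of `A`. Hence canonical splitting maps are balanced and have `A` as their algebra of
strictly local operators. If `χ` is balanced, its reverse satisfies the hypothesis above for the
commutant of `StLoc_L(χ)`, so `χ` is comprehended in the canonical splitting maps for `StLoc_L(χ)`.
Conversely, compressing operators along the isometry `g` shows that `StLoc_L` is monotone, hence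
`StLoc_R` antitone. A splitting map equivalent to a canonical one for its own algebra `StLoc_L(χ)`
therefore has the same `StLoc_R` as the latter, and is balanced.

Representation unitaries come from decomposing `H` orthogonally into irreducible `A`-invariant
subspaces. By Schur's lemma two of them are either unitarily equivalent or have no intertwiners
between them, and the double commutant theorem, obtained from Jacobson density, shows that `A`
contains all operators `⨁ i, a i ⊗ 1` (`VNAlg.exists_represents`).
-/

/-! ### Reversing a splitting map -/

namespace TensorProduct

variable {X X' M R R' : Type*} [AddCommGroup X] [Module ℂ X] [AddCommGroup X'] [Module ℂ X']
  [AddCommGroup M] [Module ℂ M] [AddCommGroup R] [Module ℂ R] [AddCommGroup R'] [Module ℂ R']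

/-- The linear map `x ⊗ (m ⊗ r) ↦ r ⊗ (m ⊗ x)`. -/
noncomputable def reverseThree (X M R : Type*) [AddCommGroup X] [Module ℂ X] [AddCommGroup M]
    [Module ℂ M] [AddCommGroup R] [Module ℂ R] :
    X ⊗[ℂ] (M ⊗[ℂ] R) →ₗ[ℂ] R ⊗[ℂ] (M ⊗[ℂ] X) :=
  (TensorProduct.assoc ℂ R M X).toLinearMap ∘ₗ (TensorProduct.comm ℂ X (R ⊗[ℂ] M)).toLinearMap ∘ₗ
    (TensorProduct.comm ℂ M R).toLinearMap.lTensor X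

@[simp]
theorem reverseThree_tmul (x : X) (m : M) (r : R) :
    reverseThree X M R (x ⊗ₜ (m ⊗ₜ r)) = r ⊗ₜ (m ⊗ₜ x) := rfl

theorem lTensor_comm_comp_comm (g : X' →ₗ[ℂ] X ⊗[ℂ] M) (z : X' ⊗[ℂ] R) :
    ((TensorProduct.comm ℂ X M).toLinearMap ∘ₗ g).lTensor R (TensorProduct.comm ℂ X' R z) =
      reverseThree X M R (TensorProduct.assoc ℂ X M R (g.rTensor R z)) := by
  induction z using TensorProduct.induction_on with
  | zero => simp
  | add a b ha hb => simp only [map_add, ha, hb]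
  | tmul a b =>
    simp only [comm_tmul, LinearMap.lTensor_tmul, LinearMap.comp_apply, LinearMap.rTensor_tmul]
    induction g a using TensorProduct.induction_on with
    | zero => simp
    | add c d hc hd => simp only [map_add, tmul_add, add_tmul, hc, hd]
    | tmul c d => simp

theorem assoc_rTensor_comm_comp_comm (f : R →ₗ[ℂ] M ⊗[ℂ] R') (z : X ⊗[ℂ] R) :
    TensorProduct.assoc ℂ R' M X
        (((TensorProduct.comm ℂ M R').toLinearMap ∘ₗ f).rTensor X (TensorProduct.comm ℂ X R z)) =
      reverseThree X M R' (f.lTensor X z) := by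
  induction z using TensorProduct.induction_on with
  | zero => simp
  | add a b ha hb => simp only [map_add, ha, hb]
  | tmul a b =>
    simp only [comm_tmul, LinearMap.lTensor_tmul, LinearMap.comp_apply, LinearMap.rTensor_tmul]
    induction f b using TensorProduct.induction_on with
    | zero => simp
    | add c d hc hd => simp only [map_add, tmul_add, add_tmul, hc, hd]
    | tmul c d => simp

theorem comm_lTensor (f : R →ₗ[ℂ] R') (z : X ⊗[ℂ] R) :
    TensorProduct.comm ℂ X R' (f.lTensor X z) = f.rTensor X (TensorProduct.comm ℂ X R z) :=
  LinearMap.congr_fun (f := (TensorProduct.comm ℂ X R').toLinearMap ∘ₗ f.lTensor X)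
    (g := f.rTensor X ∘ₗ (TensorProduct.comm ℂ X R).toLinearMap)
    (TensorProduct.ext' fun _ _ => rfl) z

theorem assoc_rTensor_rTensor (f : X →ₗ[ℂ] X') (z : (X ⊗[ℂ] M) ⊗[ℂ] R) :
    TensorProduct.assoc ℂ X' M R ((f.rTensor M).rTensor R z) =
      f.rTensor (M ⊗[ℂ] R) (TensorProduct.assoc ℂ X M R z) :=
  LinearMap.congr_fun
    (f := (TensorProduct.assoc ℂ X' M R).toLinearMap ∘ₗ (f.rTensor M).rTensor R)
    (g := f.rTensor (M ⊗[ℂ] R) ∘ₗ (TensorProduct.assoc ℂ X M R).toLinearMap)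
    (TensorProduct.ext_threefold fun _ _ _ => rfl) z

end TensorProduct

namespace SplittingMap

variable {H : Type u} [NormedAddCommGroup H] [InnerProductSpace ℂ H]

/-- The splitting map `H → R ⊗ L` obtained by exchanging the left and the right factor. -/
noncomputable def flip (χ : SplittingMap H) : SplittingMap H where
  L := χ.R
  R := χ.L
  toIsometry := (TensorProduct.commIsometry ℂ χ.L χ.R).toLinearIsometry.comp χ.toIsometry

theorem flip_flip (χ : SplittingMap H) : χ.flip.flip = χ := by
  have h : (TensorProduct.commIsometry ℂ χ.R χ.L).toLinearIsometry.comp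
      ((TensorProduct.commIsometry ℂ χ.L χ.R).toLinearIsometry.comp χ.toIsometry) =
        χ.toIsometry := by
    ext x
    simp
  exact congrArg (fun t => SplittingMap.mk χ.L χ.R t) h

/-- Exchanging left and right reverses comprehension: the two isometries change roles. -/
theorem Comprehended.flip {ζ χ : SplittingMap H} (h : ζ.Comprehended χ) :
    χ.flip.Comprehended ζ.flip := by
  obtain ⟨M, _, _, _, f, g, h⟩ := h
  refine ⟨M, inferInstance, inferInstance, inferInstance,
    (TensorProduct.commIsometry ℂ ζ.L M).toLinearIsometry.comp g,
    (TensorProduct.commIsometry ℂ M χ.R).toLinearIsometry.comp f, ?_⟩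
  ext x
  refine (TensorProduct.lTensor_comm_comp_comm g.toLinearMap (χ.toLin x)).trans
    (Eq.trans ?_ (TensorProduct.assoc_rTensor_comm_comp_comm f.toLinearMap (ζ.toLin x)).symm)
  exact congrArg _ (LinearMap.congr_fun h x).symm

theorem flip_le_flip {ζ χ : SplittingMap H} : ζ.flip ≤ χ.flip ↔ χ ≤ ζ := by
  refine ⟨fun h => ?_, Comprehended.flip⟩
  have := Comprehended.flip h
  rwa [flip_flip, flip_flip] at this

variable [FiniteDimensional ℂ H]

/-! ### Strictly local operators -/

/-- The two intertwining conditions, with the one on `χ†` replaced by its adjoint. -/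
theorem mem_stLocL_iff (χ : SplittingMap H) (A : Module.End ℂ H) :
    A ∈ χ.stLocL ↔ ∃ B : Module.End ℂ χ.L,
      (∀ x, χ.toLin (A x) = B.rTensor χ.R (χ.toLin x)) ∧
      ∀ x, χ.toLin (LinearMap.adjoint A x) = (LinearMap.adjoint B).rTensor χ.R (χ.toLin x) := by
  refine exists_congr fun B => ?_
  rw [and_comm]
  refine and_congr LinearMap.ext_iff ?_
  rw [← LinearMap.adjoint.injective.eq_iff, LinearMap.adjoint_comp, LinearMap.adjoint_comp,
    LinearMap.adjoint_rTensor, adj, LinearMap.adjoint_adjoint]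
  exact LinearMap.ext_iff

theorem mem_stLocR_iff (χ : SplittingMap H) (A : Module.End ℂ H) :
    A ∈ χ.stLocR ↔ ∃ B : Module.End ℂ χ.R,
      (∀ x, χ.toLin (A x) = B.lTensor χ.L (χ.toLin x)) ∧
      ∀ x, χ.toLin (LinearMap.adjoint A x) = (LinearMap.adjoint B).lTensor χ.L (χ.toLin x) := by
  refine exists_congr fun B => ?_
  rw [and_comm]
  refine and_congr LinearMap.ext_iff ?_
  rw [← LinearMap.adjoint.injective.eq_iff, LinearMap.adjoint_comp, LinearMap.adjoint_comp,
    LinearMap.adjoint_lTensor, adj, LinearMap.adjoint_adjoint]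
  exact LinearMap.ext_iff

theorem stLocL_flip (χ : SplittingMap H) : χ.flip.stLocL = χ.stLocR := by
  ext A
  rw [mem_stLocL_iff, mem_stLocR_iff]
  refine exists_congr fun B => ?_
  have key (C : Module.End ℂ χ.R) (x y : H) :
      χ.flip.toLin x = C.rTensor χ.flip.R (χ.flip.toLin y) ↔
        χ.toLin x = C.lTensor χ.L (χ.toLin y) := by
    rw [← (TensorProduct.comm ℂ χ.L χ.R).injective.eq_iff, TensorProduct.comm_lTensor]
    rfl
  exact and_congr (forall_congr' fun x => key _ _ _) (forall_congr' fun x => key _ _ _)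

/-- If `ζ` is comprehended in `χ` by `f` and `g`, and `B` implements a strictly `ζ`-local operator,
then the compression `g† (B ⊗ 1) g` implements the same operator for `χ`. -/
theorem stLocL_mono : Monotone (fun χ : SplittingMap H => χ.stLocL) := by
  rintro ζ χ ⟨M, _, _, _, f, g, h⟩ A hA
  rw [mem_stLocL_iff] at hA ⊢
  obtain ⟨B, h₁, h₂⟩ := hA
  have hg : LinearMap.adjoint g.toLinearMap ∘ₗ g.toLinearMap = LinearMap.id := by
    refine LinearMap.ext fun x => ext_inner_left ℂ fun y => ?_
    rw [LinearMap.comp_apply, LinearMap.adjoint_inner_right]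
    exact g.inner_map_map y x
  have key (A : Module.End ℂ H) (B : Module.End ℂ ζ.L)
      (hAB : ∀ x, ζ.toLin (A x) = B.rTensor ζ.R (ζ.toLin x)) (x : H) :
      χ.toLin (A x) = (LinearMap.adjoint g.toLinearMap ∘ₗ B.rTensor M ∘ₗ g.toLinearMap).rTensor χ.R
        (χ.toLin x) := by
    have e : g.toLinearMap.rTensor χ.R (χ.toLin (A x)) =
        (B.rTensor M).rTensor χ.R (g.toLinearMap.rTensor χ.R (χ.toLin x)) := by
      apply (TensorProduct.assoc ℂ ζ.L M χ.R).injective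
      have c₁ := LinearMap.congr_fun h (A x)
      have c₂ := LinearMap.congr_fun h x
      simp only [LinearMap.comp_apply, LinearEquiv.coe_coe] at c₁ c₂
      have hcomm : f.toLinearMap.lTensor ζ.L ∘ₗ B.rTensor ζ.R =
          B.rTensor (M ⊗[ℂ] χ.R) ∘ₗ f.toLinearMap.lTensor ζ.L := by
        rw [LinearMap.lTensor_comp_rTensor, LinearMap.rTensor_comp_lTensor]
      rw [← c₁, hAB, TensorProduct.assoc_rTensor_rTensor, ← c₂]
      exact LinearMap.congr_fun hcomm _
    calc χ.toLin (A x) = (LinearMap.adjoint g.toLinearMap ∘ₗ g.toLinearMap).rTensor χ.R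
          (χ.toLin (A x)) := by rw [hg, LinearMap.rTensor_id_apply]
      _ = _ := by
        rw [LinearMap.rTensor_comp_apply, e, LinearMap.rTensor_comp_apply,
          LinearMap.rTensor_comp_apply]
  refine ⟨_, key A B h₁, fun x => ?_⟩
  rw [key _ _ h₂]
  simp only [LinearMap.adjoint_comp, LinearMap.adjoint_adjoint, LinearMap.adjoint_rTensor,
    LinearMap.comp_assoc]

theorem stLocR_anti : Antitone (fun χ : SplittingMap H => χ.stLocR) := by
  intro ζ χ h
  have := stLocL_mono (flip_le_flip.2 h)
  simpa only [stLocL_flip] using this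

end SplittingMap

/-! ### Slicing tensors -/

namespace TensorProduct

variable {X X' R κ : Type*} [AddCommGroup X] [Module ℂ X] [AddCommGroup X'] [Module ℂ X']
  [AddCommGroup R] [Module ℂ R]

/-- The slice map `1 ⊗ φ : X ⊗ R → X` of a linear functional `φ` on `R`. -/
noncomputable def slice (X : Type*) [AddCommGroup X] [Module ℂ X] (φ : R →ₗ[ℂ] ℂ) :
    X ⊗[ℂ] R →ₗ[ℂ] X :=
  (TensorProduct.rid ℂ X).toLinearMap ∘ₗ φ.lTensor X

@[simp]
theorem slice_tmul (φ : R →ₗ[ℂ] ℂ) (x : X) (r : R) : slice X φ (x ⊗ₜ r) = φ r • x := by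
  simp [slice]

theorem slice_rTensor (φ : R →ₗ[ℂ] ℂ) (f : X →ₗ[ℂ] X') (z : X ⊗[ℂ] R) :
    slice X' φ (f.rTensor R z) = f (slice X φ z) := by
  induction z using TensorProduct.induction_on with
  | zero => simp
  | add a b ha hb => simp only [map_add, ha, hb]
  | tmul a b => simp

theorem sum_slice_tmul [Fintype κ] (b : Module.Basis κ ℂ R) (z : X ⊗[ℂ] R) :
    ∑ j, slice X (b.coord j) z ⊗ₜ[ℂ] b j = z := by
  induction z using TensorProduct.induction_on with
  | zero => simp
  | add a b ha hb => simp only [map_add, add_tmul, Finset.sum_add_distrib, ha, hb]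
  | tmul x r =>
    simp only [slice_tmul, smul_tmul]
    rw [← tmul_sum]
    congr 1
    exact b.sum_repr r

end TensorProduct

/-! ### Canonical splitting maps are balanced -/

section

variable {ι : Type u} {L R : ι → Type u}
  [∀ i, NormedAddCommGroup (L i)] [∀ i, InnerProductSpace ℂ (L i)]
  [∀ i, NormedAddCommGroup (R i)] [∀ i, InnerProductSpace ℂ (R i)]

/-- The direct sum of operators on the summands. -/
noncomputable def blockDiagonal (a : ∀ i, Module.End ℂ (L i)) : Module.End ℂ (PiLp 2 L) where
  toFun x := WithLp.toLp 2 fun i => a i (x i)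
  map_add' x y := by ext i; simp
  map_smul' c x := by ext i; simp

@[simp]
theorem blockDiagonal_apply (a : ∀ i, Module.End ℂ (L i)) (x : PiLp 2 L) (i : ι) :
    blockDiagonal a x i = a i (x i) := rfl

variable [Fintype ι]

theorem summandInclusion_apply_self (i : ι) (x : L i) : summandInclusion L i x i = x := by
  classical exact PiLp.single_eq_same 2 i x

theorem summandInclusion_apply_of_ne {i j : ι} (h : j ≠ i) (x : L i) :
    summandInclusion L i x j = 0 := by
  classical exact PiLp.single_eq_of_ne 2 h x

theorem blockDiagonal_summandInclusion (a : ∀ i, Module.End ℂ (L i)) (i : ι) (x : L i) :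
    blockDiagonal a (summandInclusion L i x) = summandInclusion L i (a i x) := by
  refine PiLp.ext fun j => ?_
  rw [blockDiagonal_apply]
  by_cases h : j = i
  · subst h
    rw [summandInclusion_apply_self, summandInclusion_apply_self]
  · rw [summandInclusion_apply_of_ne h, summandInclusion_apply_of_ne h, map_zero]

theorem blockEmbedding_apply (x : PiLp 2 (fun i => L i ⊗[ℂ] R i)) :
    blockEmbedding L R x =
      ∑ i, TensorProduct.map (summandInclusion L i).toLinearMap
        (summandInclusion R i).toLinearMap (x i) :=
  blockEmbeddingLin_apply L R x

theorem rTensor_blockDiagonal_blockEmbedding (a : ∀ i, Module.End ℂ (L i))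
    (x : PiLp 2 (fun i => L i ⊗[ℂ] R i)) :
    (blockDiagonal a).rTensor (PiLp 2 R) (blockEmbedding L R x) =
      blockEmbedding L R (blockDiagonal (fun i => (a i).rTensor (R i)) x) := by
  rw [blockEmbedding_apply, blockEmbedding_apply, map_sum]
  refine Finset.sum_congr rfl fun i _ => ?_
  rw [blockDiagonal_apply]
  induction x i using TensorProduct.induction_on with
  | zero => simp
  | add a b ha hb => simp only [map_add, ha, hb]
  | tmul l r => simp [blockDiagonal_summandInclusion]

/-- Between the block embedding and the projection onto `L i ⊗ R i`, an operator `B ⊗ 1` acts as the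
compression of `B` to `L i`. -/
theorem map_proj_rTensor_blockEmbedding (B : Module.End ℂ (PiLp 2 L))
    (x : PiLp 2 (fun i => L i ⊗[ℂ] R i)) (i : ι) :
    TensorProduct.map (PiLp.projₗ 2 L i) (PiLp.projₗ 2 R i)
        (B.rTensor (PiLp 2 R) (blockEmbedding L R x)) =
      (PiLp.projₗ 2 L i ∘ₗ B ∘ₗ (summandInclusion L i).toLinearMap).rTensor (R i) (x i) := by
  rw [blockEmbedding_apply, map_sum, map_sum, Finset.sum_eq_single i]
  · induction x i using TensorProduct.induction_on with
    | zero => simp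
    | add a b ha hb => simp only [map_add, ha, hb]
    | tmul l r => simp [summandInclusion_apply_self]
  · intro j _ hj
    induction x j using TensorProduct.induction_on with
    | zero => simp
    | add a b ha hb => simp only [map_add, ha, hb, add_zero]
    | tmul l r => simp [summandInclusion_apply_of_ne hj.symm]
  · simp

end

/-- An operator on `X ⊗ R` commuting with `L(X) ⊗ 1` lies in `1 ⊗ L(R)`. -/
theorem exists_eq_lTensor_of_commute {X R : Type*} [AddCommGroup X] [Module ℂ X] [Nontrivial X]
    [AddCommGroup R] [Module ℂ R] (T : Module.End ℂ (X ⊗[ℂ] R))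
    (hT : ∀ (a : Module.End ℂ X) z, T (a.rTensor R z) = a.rTensor R (T z)) :
    ∃ b : Module.End ℂ R, T = b.lTensor X := by
  obtain ⟨e, he⟩ := exists_ne (0 : X)
  obtain ⟨φ, hφ⟩ := Module.Projective.exists_dual_eq_one ℂ he
  have key (x : X) (z : X ⊗[ℂ] R) : (φ.smulRight x).rTensor R z =
      x ⊗ₜ TensorProduct.slice R φ (TensorProduct.comm ℂ X R z) := by
    induction z using TensorProduct.induction_on with
    | zero => simp
    | add a b ha hb => simp only [map_add, TensorProduct.tmul_add, ha, hb]
    | tmul a b => simp [TensorProduct.smul_tmul]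
  refine ⟨TensorProduct.slice R φ ∘ₗ (TensorProduct.comm ℂ X R).toLinearMap ∘ₗ T ∘ₗ
    TensorProduct.mk ℂ X R e, TensorProduct.ext' fun x r => ?_⟩
  have h := hT (φ.smulRight x) (e ⊗ₜ r)
  rw [LinearMap.rTensor_tmul, key, LinearMap.smulRight_apply, hφ, one_smul] at h
  exact h

namespace BlockDecomposition

variable {H : Type u} [NormedAddCommGroup H] [InnerProductSpace ℂ H]

/-- The operator `U† (⨁ i, a i ⊗ 1) U` on `H`. -/
noncomputable def leftOp (D : BlockDecomposition H) (a : ∀ i, Module.End ℂ (D.L i)) :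
    Module.End ℂ H :=
  D.U.symm.toLinearMap ∘ₗ blockDiagonal (fun i => (a i).rTensor (D.R i)) ∘ₗ D.U.toLinearMap

theorem U_leftOp (D : BlockDecomposition H) (a : ∀ i, Module.End ℂ (D.L i)) (x : H) :
    D.U (D.leftOp a x) = blockDiagonal (fun i => (a i).rTensor (D.R i)) (D.U x) :=
  D.U.apply_symm_apply _

theorem splittingMap_toLin_apply (D : BlockDecomposition H) (x : H) :
    D.splittingMap.toLin x = blockEmbedding D.L D.R (D.U x) := rfl

theorem splittingMap_leftOp (D : BlockDecomposition H) (a : ∀ i, Module.End ℂ (D.L i)) (x : H) :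
    D.splittingMap.toLin (D.leftOp a x) =
      (blockDiagonal a).rTensor (PiLp 2 D.R) (D.splittingMap.toLin x) := by
  rw [splittingMap_toLin_apply, splittingMap_toLin_apply, U_leftOp,
    rTensor_blockDiagonal_blockEmbedding]

/-- The block decomposition with the two factors of each block exchanged. -/
noncomputable def flip (D : BlockDecomposition H) : BlockDecomposition H where
  ι := D.ι
  L := D.R
  R := D.L
  U := D.U.trans
    (LinearIsometryEquiv.piLpCongrRight 2 fun i => TensorProduct.commIsometry ℂ (D.L i) (D.R i))

theorem splittingMap_flip (D : BlockDecomposition H) :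
    D.flip.splittingMap = D.splittingMap.flip := by
  have h : (blockEmbedding D.R D.L).comp D.flip.U.toLinearIsometry =
      (TensorProduct.commIsometry ℂ (PiLp 2 D.L) (PiLp 2 D.R)).toLinearIsometry.comp
        ((blockEmbedding D.L D.R).comp D.U.toLinearIsometry) := by
    refine LinearIsometry.ext fun x => ?_
    change blockEmbedding D.R D.L (WithLp.toLp 2 fun i => TensorProduct.comm ℂ _ _ (D.U x i)) =
      TensorProduct.comm ℂ (PiLp 2 D.L) (PiLp 2 D.R) (blockEmbedding D.L D.R (D.U x))
    rw [blockEmbedding_apply, blockEmbedding_apply, map_sum]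
    exact Finset.sum_congr rfl fun i _ => TensorProduct.map_comm _ _ _
  exact congrArg (fun t => SplittingMap.mk (PiLp 2 D.R) (PiLp 2 D.L) t) h

theorem U_apply_of_intertwines (D : BlockDecomposition H) (T : Module.End ℂ H)
    (B : Module.End ℂ (PiLp 2 D.L))
    (hB : ∀ x, blockEmbedding D.L D.R (D.U (T x)) =
      B.rTensor (PiLp 2 D.R) (blockEmbedding D.L D.R (D.U x))) (x : H) (i : D.ι) :
    D.U (T x) i = (PiLp.projₗ 2 D.L i ∘ₗ B ∘ₗ (summandInclusion D.L i).toLinearMap).rTensor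
      (D.R i) (D.U x i) := by
  have e := map_proj_rTensor_blockEmbedding LinearMap.id (D.U (T x)) i
  have e₁ : PiLp.projₗ 2 D.L i ∘ₗ LinearMap.id ∘ₗ (summandInclusion D.L i).toLinearMap =
      LinearMap.id := LinearMap.ext fun l => summandInclusion_apply_self i l
  rw [e₁, LinearMap.rTensor_id_apply, LinearMap.rTensor_id_apply] at e
  rw [← map_proj_rTensor_blockEmbedding, ← hB, e]

variable [FiniteDimensional ℂ H]

theorem adjoint_leftOp (D : BlockDecomposition H) (a : ∀ i, Module.End ℂ (D.L i)) :
    LinearMap.adjoint (D.leftOp a) = D.leftOp fun i => LinearMap.adjoint (a i) := by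
  refine ((LinearMap.eq_adjoint_iff _ _).2 fun x y => ?_).symm
  rw [← D.U.inner_map_map, ← D.U.inner_map_map x, U_leftOp, U_leftOp, PiLp.inner_apply,
    PiLp.inner_apply]
  refine Finset.sum_congr rfl fun i _ => ?_
  rw [blockDiagonal_apply, blockDiagonal_apply, ← LinearMap.adjoint_rTensor,
    LinearMap.adjoint_inner_left]

theorem Represents.mem_iff {D : BlockDecomposition H} {A : VNAlg H} (h : D.Represents A)
    {T : Module.End ℂ H} : T ∈ A ↔ ∃ a, T = D.leftOp a := by
  rw [h T]
  refine exists_congr fun a => ⟨fun ha => ?_, ?_⟩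
  · refine LinearMap.ext fun x => D.U.injective (PiLp.ext fun i => ?_)
    rw [ha, U_leftOp, blockDiagonal_apply]
  · rintro rfl x i
    rw [U_leftOp, blockDiagonal_apply]

theorem Represents.leftOp_mem {D : BlockDecomposition H} {A : VNAlg H} (h : D.Represents A)
    (a : ∀ i, Module.End ℂ (D.L i)) : D.leftOp a ∈ A :=
  h.mem_iff.2 ⟨a, rfl⟩

theorem Represents.stLocL_splittingMap {D : BlockDecomposition H} {A : VNAlg H}
    (h : D.Represents A) : D.splittingMap.stLocL = A := by
  ext T
  rw [SplittingMap.mem_stLocL_iff]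
  constructor
  · rintro ⟨B, hB, -⟩
    exact (h T).2 ⟨_, D.U_apply_of_intertwines T B hB⟩
  · intro hT
    obtain ⟨a, rfl⟩ := h.mem_iff.1 hT
    refine ⟨blockDiagonal a, D.splittingMap_leftOp a, fun x => ?_⟩
    have e₂ : LinearMap.adjoint (blockDiagonal a) =
        blockDiagonal fun i => LinearMap.adjoint (a i) := by
      refine ((LinearMap.eq_adjoint_iff _ _).2 fun x y => ?_).symm
      simp only [PiLp.inner_apply, blockDiagonal_apply, LinearMap.adjoint_inner_left]
    rw [adjoint_leftOp]
    refine (D.splittingMap_leftOp _ x).trans ?_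
    rw [← e₂]
    rfl

/-- The commutant of `⨁ i, L(L i) ⊗ 1` is `⨁ i, 1 ⊗ L(R i)`. -/
theorem Represents.flip {D : BlockDecomposition H} {A : VNAlg H} (h : D.Represents A) :
    D.flip.Represents (StarSubalgebra.centralizer ℂ (A : Set (Module.End ℂ H))) := by
  classical
  intro T
  -- In terms of `D`, the condition on `T` is `U T = (⨁ i, 1 ⊗ b i) U`.
  have hflip : (∃ b : ∀ i, Module.End ℂ (D.R i), ∀ (x : H) (i : D.ι),
      TensorProduct.comm ℂ (D.L i) (D.R i) (D.U (T x) i) =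
        (b i).rTensor (D.L i) (TensorProduct.comm ℂ (D.L i) (D.R i) (D.U x i))) ↔
      ∃ b : ∀ i, Module.End ℂ (D.R i), ∀ (x : H) (i : D.ι),
        D.U (T x) i = (b i).lTensor (D.L i) (D.U x i) := by
    refine exists_congr fun b => forall_congr' fun x => forall_congr' fun i => ?_
    rw [← TensorProduct.comm_lTensor]
    exact (TensorProduct.comm ℂ (D.L i) (D.R i)).injective.eq_iff
  refine Iff.trans ?_ hflip.symm
  rw [StarSubalgebra.mem_centralizer_iff]
  constructor
  · intro hT
    have hcomm (a : ∀ i, Module.End ℂ (D.L i)) (x : H) :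
        T (D.leftOp a x) = D.leftOp a (T x) :=
      (LinearMap.congr_fun (hT _ (h.leftOp_mem a)).1 x).symm
    let block (i : D.ι) : Module.End ℂ (D.L i ⊗[ℂ] D.R i) :=
      PiLp.projₗ 2 (fun i => D.L i ⊗[ℂ] D.R i) i ∘ₗ D.U.toLinearMap ∘ₗ T ∘ₗ
        D.U.symm.toLinearMap ∘ₗ (summandInclusion (fun i => D.L i ⊗[ℂ] D.R i) i).toLinearMap
    -- `T` is tested against the operators `0 ⊕ ⋯ ⊕ a ⊕ ⋯ ⊕ 0` of `A`, supported on block `i`.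
    have hup (i : D.ι) (a : Module.End ℂ (D.L i)) (x : H) :
        D.leftOp (Function.update 0 i a) x =
          D.U.symm (summandInclusion (fun i => D.L i ⊗[ℂ] D.R i) i (a.rTensor _ (D.U x i))) := by
      apply D.U.injective
      rw [U_leftOp, LinearIsometryEquiv.apply_symm_apply]
      refine PiLp.ext fun j => ?_
      rw [blockDiagonal_apply]
      by_cases hj : j = i
      · subst hj
        rw [Function.update_self, summandInclusion_apply_self]
      · rw [Function.update_of_ne hj, summandInclusion_apply_of_ne hj]
        simp
    have hblock (x : H) (i : D.ι) (a : Module.End ℂ (D.L i)) :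
        block i (a.rTensor _ (D.U x i)) = a.rTensor _ (D.U (T x) i) := by
      have e := congrArg (fun y => D.U y i) (hcomm (Function.update 0 i a) x)
      simp only [hup i a, LinearIsometryEquiv.apply_symm_apply, summandInclusion_apply_self] at e
      exact e
    have hblock₁ (x : H) (i : D.ι) : block i (D.U x i) = D.U (T x) i := by
      simpa only [LinearMap.rTensor_id_apply] using hblock x i LinearMap.id
    have hex (i : D.ι) : ∃ b : Module.End ℂ (D.R i), block i = b.lTensor (D.L i) := by
      refine exists_eq_lTensor_of_commute _ fun a z => ?_
      have e := hblock (D.U.symm (summandInclusion (fun i => D.L i ⊗[ℂ] D.R i) i z)) i a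
      rw [← hblock₁, LinearIsometryEquiv.apply_symm_apply, summandInclusion_apply_self] at e
      exact e
    choose b hb using hex
    exact ⟨b, fun x i => by rw [← hblock₁, hb]⟩
  · rintro ⟨b, hb⟩
    have key : ∀ g ∈ A, g * T = T * g := by
      intro g hg
      obtain ⟨a, ha⟩ := (h g).1 hg
      refine LinearMap.ext fun x => D.U.injective (PiLp.ext fun i => ?_)
      rw [Module.End.mul_apply, Module.End.mul_apply, ha, hb, hb, ha, ← LinearMap.comp_apply,
        ← LinearMap.comp_apply, LinearMap.lTensor_comp_rTensor, LinearMap.rTensor_comp_lTensor]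
    exact fun g hg => ⟨key g hg, key _ (star_mem hg)⟩

end BlockDecomposition

theorem coe_centralizer_vNAlg {H : Type u} [NormedAddCommGroup H] [InnerProductSpace ℂ H]
    [FiniteDimensional ℂ H] (A : VNAlg H) :
    (StarSubalgebra.centralizer ℂ (A : Set (Module.End ℂ H)) : Set (Module.End ℂ H)) =
      Set.centralizer (A : Set (Module.End ℂ H)) := by
  rw [StarSubalgebra.coe_centralizer]
  congr 1
  refine Set.union_eq_self_of_subset_right fun T hT => ?_
  simpa using star_mem (s := A) hT

theorem SplittingMap.isBalanced_iff {H : Type u} [NormedAddCommGroup H] [InnerProductSpace ℂ H]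
    [FiniteDimensional ℂ H] (χ : SplittingMap H) :
    χ.IsBalanced ↔
      χ.stLocR = StarSubalgebra.centralizer ℂ (χ.stLocL : Set (Module.End ℂ H)) := by
  rw [← SetLike.coe_set_eq, coe_centralizer_vNAlg, IsBalanced]

theorem BlockDecomposition.Represents.isBalanced {H : Type u} [NormedAddCommGroup H]
    [InnerProductSpace ℂ H] [FiniteDimensional ℂ H] {D : BlockDecomposition H} {A : VNAlg H}
    (h : D.Represents A) : D.splittingMap.IsBalanced := by
  rw [SplittingMap.isBalanced_iff, h.stLocL_splittingMap, ← h.flip.stLocL_splittingMap,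
    splittingMap_flip, SplittingMap.stLocL_flip]

/-! ### Left supports and the construction of comprehensions -/

namespace SplittingMap

variable {H : Type u} [NormedAddCommGroup H] [InnerProductSpace ℂ H]

/-- The orthogonal projection `P` onto the left support of `χ`, the smallest subspace `S` of `L`
with `χ(H) ⊆ S ⊗ R`. Operators on `L` matter for `χ` only through their restriction to `S`. -/
theorem exists_leftSupport (χ : SplittingMap H) :
    ∃ P : Module.End ℂ χ.L, LinearMap.adjoint P = P ∧ P ∘ₗ P = P ∧
      (∀ x, P.rTensor χ.R (χ.toLin x) = χ.toLin x) ∧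
      ∀ C : Module.End ℂ χ.L, (∀ x, C.rTensor χ.R (χ.toLin x) = 0) → C ∘ₗ P = 0 := by
  let b := Module.finBasis ℂ χ.R
  let S : Submodule ℂ χ.L := Submodule.span ℂ
    (Set.range fun p : Fin (Module.finrank ℂ χ.R) × H =>
      TensorProduct.slice χ.L (b.coord p.1) (χ.toLin p.2))
  let P : Module.End ℂ χ.L := S.starProjection.toLinearMap
  have hP (x : χ.L) (hx : x ∈ S) : P x = x := Submodule.starProjection_eq_self_iff.2 hx
  have hPS (x : χ.L) : P x ∈ S := Submodule.starProjection_apply_mem S x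
  refine ⟨P, ?_, LinearMap.ext fun x => hP _ (hPS x), fun x => ?_, fun C hC => ?_⟩
  · refine ((LinearMap.eq_adjoint_iff _ _).2 fun x y => ?_).symm
    exact Submodule.inner_starProjection_left_eq_right S x y
  · rw [← TensorProduct.sum_slice_tmul b (χ.toLin x), map_sum]
    refine Finset.sum_congr rfl fun j _ => ?_
    rw [LinearMap.rTensor_tmul, hP]
    exact Submodule.subset_span ⟨(j, x), rfl⟩
  · refine LinearMap.ext fun x => ?_
    have : S ≤ LinearMap.ker C := by
      refine Submodule.span_le.2 ?_
      rintro _ ⟨⟨j, y⟩, rfl⟩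
      change C (TensorProduct.slice χ.L (b.coord j) (χ.toLin y)) = 0
      rw [← TensorProduct.slice_rTensor, hC, map_zero]
    exact this (hPS x)

variable [FiniteDimensional ℂ H]

/-- A criterion for comprehension. The strictly `χ`-local operators `E k` with `∑ (E k)† E k = 1`
are implemented by operators `B k` on `L_χ`, and `m ↦ ∑ e k ⊗ B k m` is isometric on the left
support of `χ`, with values in `L_ζ ⊗ (left support)`. The orthogonal complement of the left
support is mapped isometrically to `e₀ ⊗ (left support)ᗮ`. -/
theorem comprehended_of_sum_adjoint_comp {ζ χ : SplittingMap H} [Nontrivial ζ.L]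
    {κ : Type*} [Fintype κ] (e : κ → ζ.L) (he : Orthonormal ℂ e)
    (E : κ → Module.End ℂ H) (hE : ∀ k, E k ∈ χ.stLocL)
    (hsum : ∑ k, LinearMap.adjoint (E k) ∘ₗ E k = LinearMap.id)
    (f : ζ.R →ₗᵢ[ℂ] χ.L ⊗[ℂ] χ.R)
    (hf : ∀ x, f.toLinearMap.lTensor ζ.L (ζ.toLin x) = ∑ k, e k ⊗ₜ χ.toLin (E k x)) :
    ζ ≤ χ := by
  classical
  choose B hB hB' using fun k => (χ.mem_stLocL_iff (E k)).1 (hE k)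
  obtain ⟨P, hPadj, hPP, hPχ, hP⟩ := χ.exists_leftSupport
  obtain ⟨e₀, he₀⟩ := exists_norm_eq ζ.L zero_le_one
  have hPP' (m : χ.L) : P (P m) = P m := LinearMap.congr_fun hPP m
  have hPinner (l m : χ.L) : inner ℂ (P l) m = inner ℂ l (P m) := by
    rw [← LinearMap.adjoint_inner_right, hPadj]
  -- `B k` preserves the left support.
  have hPB (k : κ) (m : χ.L) : P (B k (P m)) = B k (P m) := by
    have := hP ((LinearMap.id - P) ∘ₗ B k) fun x => by
      rw [LinearMap.rTensor_comp_apply, ← hB, LinearMap.rTensor_sub, LinearMap.sub_apply, hPχ,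
        LinearMap.rTensor_id_apply, sub_self]
    have := LinearMap.congr_fun this m
    simp only [LinearMap.comp_apply, LinearMap.sub_apply, LinearMap.id_apply,
      LinearMap.zero_apply] at this
    exact (sub_eq_zero.1 this).symm
  have hBB (m : χ.L) : ∑ k, LinearMap.adjoint (B k) (B k (P m)) = P m := by
    have := hP (∑ k, LinearMap.adjoint (B k) ∘ₗ B k - LinearMap.id) fun x => by
      rw [LinearMap.rTensor_sub, LinearMap.sub_apply, LinearMap.rTensor_id_apply, sub_eq_zero]
      have h₁ : (∑ k, LinearMap.adjoint (B k) ∘ₗ B k).rTensor χ.R =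
          ∑ k, (LinearMap.adjoint (B k) ∘ₗ B k).rTensor χ.R :=
        map_sum (LinearMap.rTensorHom χ.R) _ _
      have h₂ := congrArg χ.toLin (LinearMap.congr_fun hsum x)
      rw [LinearMap.sum_apply, map_sum, LinearMap.id_apply] at h₂
      rw [h₁, LinearMap.sum_apply]
      refine Eq.trans (Finset.sum_congr rfl fun k _ => ?_) h₂
      rw [LinearMap.rTensor_comp_apply, ← hB, ← hB', LinearMap.comp_apply]
    have := LinearMap.congr_fun this m
    simp only [LinearMap.comp_apply, LinearMap.sub_apply, LinearMap.id_apply,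
      LinearMap.zero_apply, LinearMap.sum_apply] at this
    exact sub_eq_zero.1 this
  let g : χ.L →ₗ[ℂ] ζ.L ⊗[ℂ] χ.L :=
    ∑ k, TensorProduct.mk ℂ ζ.L χ.L (e k) ∘ₗ B k ∘ₗ P +
      TensorProduct.mk ℂ ζ.L χ.L e₀ ∘ₗ (LinearMap.id - P)
  have hg (m : χ.L) : g m = ∑ k, e k ⊗ₜ[ℂ] B k (P m) + e₀ ⊗ₜ[ℂ] (m - P m) := by
    simp only [g, LinearMap.add_apply, LinearMap.sum_apply, LinearMap.comp_apply,
      TensorProduct.mk_apply, LinearMap.sub_apply, LinearMap.id_apply]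
  have hcross (k : κ) (l m : χ.L) : inner ℂ (B k (P l)) (m - P m) = 0 := by
    rw [← hPB, hPinner, map_sub, hPP', sub_self, inner_zero_right]
  have hcross' (k : κ) (l m : χ.L) : inner ℂ (m - P m) (B k (P l)) = 0 := by
    rw [← inner_conj_symm, hcross, map_zero]
  have hg_inner (l m : χ.L) : inner ℂ (g l) (g m) = inner ℂ l m := by
    have h₁ : inner ℂ (∑ k, e k ⊗ₜ[ℂ] B k (P l)) (∑ k, e k ⊗ₜ[ℂ] B k (P m)) =
        inner ℂ (P l) (P m) := by
      refine Eq.trans ?_ (congrArg (inner ℂ (P l)) (hBB m))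
      rw [sum_inner, inner_sum]
      refine Finset.sum_congr rfl fun k _ => ?_
      rw [inner_sum, Finset.sum_eq_single k]
      · rw [TensorProduct.inner_tmul, inner_self_eq_norm_sq_to_K, he.1 k,
          LinearMap.adjoint_inner_right]
        simp
      · intro k' _ hk'
        rw [TensorProduct.inner_tmul, he.2 hk'.symm, zero_mul]
      · simp
    have h₂ : inner ℂ (∑ k, e k ⊗ₜ[ℂ] B k (P l)) (e₀ ⊗ₜ[ℂ] (m - P m)) = 0 := by
      rw [sum_inner]
      exact Finset.sum_eq_zero fun k _ => by rw [TensorProduct.inner_tmul, hcross, mul_zero]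
    have h₃ : inner ℂ (e₀ ⊗ₜ[ℂ] (l - P l)) (∑ k, e k ⊗ₜ[ℂ] B k (P m)) = 0 := by
      rw [inner_sum]
      exact Finset.sum_eq_zero fun k _ => by rw [TensorProduct.inner_tmul, hcross', mul_zero]
    have h₄ : inner ℂ (P l) (P m) = inner ℂ l (P m) := by rw [hPinner, hPP']
    rw [hg, hg, inner_add_left, inner_add_right, inner_add_right, h₁, h₂, h₃,
      TensorProduct.inner_tmul, inner_self_eq_norm_sq_to_K, he₀, h₄, inner_sub_left,
      inner_sub_right, inner_sub_right, h₄, hPinner]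
    simp
  refine ⟨χ.L, inferInstance, inferInstance, inferInstance, f, g.isometryOfInner hg_inner, ?_⟩
  refine LinearMap.ext fun x => ?_
  have hz (z : χ.L ⊗[ℂ] χ.R) : TensorProduct.assoc ℂ ζ.L χ.L χ.R (g.rTensor χ.R z) =
      ∑ k, e k ⊗ₜ[ℂ] (B k).rTensor χ.R (P.rTensor χ.R z) + e₀ ⊗ₜ[ℂ] (z - P.rTensor χ.R z) := by
    induction z using TensorProduct.induction_on with
    | zero => simp
    | add a b ha hb =>
      simp only [map_add, ha, hb, TensorProduct.tmul_add, Finset.sum_add_distrib,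
        TensorProduct.tmul_sub]
      abel
    | tmul m r =>
      rw [LinearMap.rTensor_tmul, hg, TensorProduct.add_tmul, TensorProduct.sum_tmul, map_add,
        map_sum]
      simp only [TensorProduct.assoc_tmul, LinearMap.rTensor_tmul, TensorProduct.sub_tmul]
  refine (hf x).trans (Eq.trans ?_ (hz (χ.toLin x)).symm)
  rw [hPχ, sub_self, TensorProduct.tmul_zero, add_zero]
  exact Finset.sum_congr rfl fun k _ => by rw [hB]

end SplittingMap

/-! ### Comprehension of canonical splitting maps -/

theorem orthonormal_summandInclusion {ι : Type u} [Fintype ι] {L : ι → Type u}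
    [∀ i, NormedAddCommGroup (L i)] [∀ i, InnerProductSpace ℂ (L i)] {κ : ι → Type*}
    [∀ i, Fintype (κ i)] (e : ∀ i, OrthonormalBasis (κ i) ℂ (L i)) :
    Orthonormal ℂ fun k : Σ i, κ i => summandInclusion L k.1 (e k.1 k.2) := by
  refine ⟨fun k => ?_, ?_⟩
  · rw [LinearIsometry.norm_map]
    exact (e k.1).orthonormal.1 _
  · rintro ⟨i, k⟩ ⟨j, l⟩ h
    by_cases hij : i = j
    · subst hij
      have hkl : k ≠ l := fun h' => h (by rw [h'])
      exact (LinearIsometry.inner_map_map _ _ _).trans ((e i).orthonormal.2 hkl)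
    · exact inner_summandInclusion_of_ne L hij _ _

/-- The sum over `k` of the operators `(|e k⟩⟨u| |u⟩⟨e k|) ⊗ 1` is the identity, in weak form. -/
theorem sum_inner_rTensor_smulRight {X R κ : Type*} [NormedAddCommGroup X] [InnerProductSpace ℂ X]
    [NormedAddCommGroup R] [InnerProductSpace ℂ R] [Fintype κ] (e : OrthonormalBasis κ ℂ X)
    (u : X) (hu : ‖u‖ = 1) (z w : X ⊗[ℂ] R) :
    ∑ k, inner ℂ (((innerₛₗ ℂ (e k)).smulRight u).rTensor R z)
      (((innerₛₗ ℂ (e k)).smulRight u).rTensor R w) = inner ℂ z w := by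
  induction z using TensorProduct.induction_on with
  | zero => simp
  | add a b ha hb => simp only [map_add, inner_add_left, Finset.sum_add_distrib, ha, hb]
  | tmul x r =>
    induction w using TensorProduct.induction_on with
    | zero => simp
    | add a b ha hb => simp only [map_add, inner_add_right, Finset.sum_add_distrib, ha, hb]
    | tmul y s =>
      simp only [LinearMap.rTensor_tmul, LinearMap.smulRight_apply, innerₛₗ_apply_apply,
        TensorProduct.inner_tmul, inner_smul_left, inner_smul_right,
        inner_self_eq_norm_sq_to_K, hu]
      rw [← e.sum_inner_mul_inner x y, Finset.sum_mul]
      refine Finset.sum_congr rfl fun k _ => ?_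
      rw [inner_conj_symm]
      push_cast
      ring

/-- Matrix units move a vector from the left to the right: if `f ∘ s` is `r ↦ W (u ⊗ r)`, then
`(1 ⊗ f) (j ⊗ s) = ∑ k, j (e k) ⊗ W (|u⟩⟨e k| ⊗ 1)`. -/
theorem lTensor_map_eq_sum {X X' R R' Y κ : Type*} [NormedAddCommGroup X] [InnerProductSpace ℂ X]
    [AddCommGroup X'] [Module ℂ X'] [AddCommGroup R] [Module ℂ R] [AddCommGroup R'] [Module ℂ R']
    [AddCommGroup Y] [Module ℂ Y] [Fintype κ] (e : OrthonormalBasis κ ℂ X) (u : X)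
    (j : X →ₗ[ℂ] X') (s : R →ₗ[ℂ] R') (f : R' →ₗ[ℂ] Y) (W : X ⊗[ℂ] R →ₗ[ℂ] Y)
    (h : ∀ r, f (s r) = W (u ⊗ₜ r)) (z : X ⊗[ℂ] R) :
    f.lTensor X' (TensorProduct.map j s z) =
      ∑ k, j (e k) ⊗ₜ[ℂ] W (((innerₛₗ ℂ (e k)).smulRight u).rTensor R z) := by
  induction z using TensorProduct.induction_on with
  | zero => simp
  | add a b ha hb => simp only [map_add, ha, hb, TensorProduct.tmul_add, Finset.sum_add_distrib]
  | tmul l r =>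
    rw [TensorProduct.map_tmul, LinearMap.lTensor_tmul, h, ← e.sum_repr' l, map_sum,
      TensorProduct.sum_tmul]
    refine Finset.sum_congr rfl fun k _ => ?_
    rw [e.sum_repr' l, LinearMap.rTensor_tmul, LinearMap.smulRight_apply, innerₛₗ_apply_apply,
      map_smul, TensorProduct.smul_tmul, ← map_smul, TensorProduct.smul_tmul']

namespace BlockDecomposition

variable {H : Type u} [NormedAddCommGroup H] [InnerProductSpace ℂ H]

/-- The vectors `u i ⊗ r i`, for unit vectors `u i`, form an isometric copy of `⨁ i, R i` in
`⨁ i, L i ⊗ R i`. -/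
noncomputable def tmulIsometry (D : BlockDecomposition H) (u : ∀ i, D.L i) (hu : ∀ i, ‖u i‖ = 1) :
    PiLp 2 D.R →ₗᵢ[ℂ] PiLp 2 fun i => D.L i ⊗[ℂ] D.R i :=
  LinearMap.isometryOfInner
    { toFun := fun r => WithLp.toLp 2 fun i => u i ⊗ₜ r i
      map_add' := fun x y => by ext i; simp [TensorProduct.tmul_add]
      map_smul' := fun c x => by ext i; simp }
    fun x y => by
      simp only [PiLp.inner_apply]
      refine Finset.sum_congr rfl fun i _ => ?_
      change inner ℂ (u i ⊗ₜ[ℂ] x i) (u i ⊗ₜ[ℂ] y i) = _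
      rw [TensorProduct.inner_tmul, inner_self_eq_norm_sq_to_K, hu]
      simp

theorem tmulIsometry_apply (D : BlockDecomposition H) (u : ∀ i, D.L i) (hu : ∀ i, ‖u i‖ = 1)
    (r : PiLp 2 D.R) (i : D.ι) : D.tmulIsometry u hu r i = u i ⊗ₜ r i := rfl

variable [FiniteDimensional ℂ H]

/-- If `D` represents `A` and all operators in `A` are strictly `χ`-local, then the canonical
splitting map of `D` is comprehended in `χ`. The isometry on the right factor is
`f(⨁ i, r i) = χ(U†(⨁ i, u i ⊗ r i))` for unit vectors `u i ∈ L i`; the operators entering the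
criterion are the matrix units `|u i⟩⟨e i k| ⊗ 1` of `A`. -/
theorem Represents.splittingMap_le [Nontrivial H] {D : BlockDecomposition H} {A : VNAlg H}
    (h : D.Represents A) {χ : SplittingMap H} (hχ : A ≤ χ.stLocL) : D.splittingMap ≤ χ := by
  classical
  choose u hu using fun i => exists_norm_eq (D.L i) zero_le_one
  let e (i : D.ι) := stdOrthonormalBasis ℂ (D.L i)
  let E (k : Σ i, Fin (Module.finrank ℂ (D.L i))) : Module.End ℂ H :=
    D.leftOp (Function.update 0 k.1 ((innerₛₗ ℂ (e k.1 k.2)).smulRight (u k.1)))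
  have hUE (k) (x : H) : D.U (E k x) = summandInclusion (fun i => D.L i ⊗[ℂ] D.R i) k.1
      (((innerₛₗ ℂ (e k.1 k.2)).smulRight (u k.1)).rTensor _ (D.U x k.1)) := by
    rw [U_leftOp]
    refine PiLp.ext fun j => ?_
    rw [blockDiagonal_apply]
    by_cases hj : j = k.1
    · subst hj
      rw [Function.update_self, summandInclusion_apply_self]
    · rw [Function.update_of_ne hj, summandInclusion_apply_of_ne hj]
      simp
  obtain ⟨i₀⟩ : Nonempty D.ι := by
    by_contra hne
    rw [not_nonempty_iff] at hne
    have : Subsingleton H := D.U.toEquiv.injective.subsingleton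
    exact not_subsingleton H this
  have : Nontrivial (PiLp 2 D.L) :=
    (summandInclusion D.L i₀).injective.nontrivial
  have : Nontrivial D.splittingMap.L := this
  let f : PiLp 2 D.R →ₗᵢ[ℂ] χ.L ⊗[ℂ] χ.R :=
    χ.toIsometry.comp (D.U.symm.toLinearIsometry.comp (D.tmulIsometry u hu))
  refine SplittingMap.comprehended_of_sum_adjoint_comp (ζ := D.splittingMap)
    (fun k : Σ i, Fin (Module.finrank ℂ (D.L i)) => summandInclusion D.L k.1 (e k.1 k.2))
    (orthonormal_summandInclusion e) E (fun k => hχ (h.leftOp_mem _)) ?_ f fun x => ?_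
  · refine LinearMap.ext fun x => ext_inner_left ℂ fun y => ?_
    rw [LinearMap.sum_apply, inner_sum, LinearMap.id_apply, ← D.U.inner_map_map, PiLp.inner_apply,
      Fintype.sum_sigma]
    refine Finset.sum_congr rfl fun i _ => ?_
    rw [← sum_inner_rTensor_smulRight (e i) (u i) (hu i)]
    refine Finset.sum_congr rfl fun k _ => ?_
    rw [LinearMap.comp_apply, LinearMap.adjoint_inner_right, ← D.U.inner_map_map, hUE, hUE,
      LinearIsometry.inner_map_map]
  · change f.toLinearMap.lTensor (PiLp 2 D.L) (blockEmbedding D.L D.R (D.U x)) = _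
    rw [blockEmbedding_apply, map_sum, Fintype.sum_sigma]
    refine Finset.sum_congr rfl fun i _ => ?_
    have hf (r : D.R i) : f (summandInclusion D.R i r) =
        χ.toLin (D.U.symm (summandInclusion (fun i => D.L i ⊗[ℂ] D.R i) i (u i ⊗ₜ r))) := by
      have : D.tmulIsometry u hu (summandInclusion D.R i r) =
          summandInclusion (fun i => D.L i ⊗[ℂ] D.R i) i (u i ⊗ₜ r) := by
        refine PiLp.ext fun j => ?_
        rw [tmulIsometry_apply]
        by_cases hj : j = i
        · subst hj
          rw [summandInclusion_apply_self, summandInclusion_apply_self]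
        · rw [summandInclusion_apply_of_ne hj, summandInclusion_apply_of_ne hj,
            TensorProduct.tmul_zero]
      rw [← this]
      rfl
    refine (lTensor_map_eq_sum (e i) (u i) (summandInclusion D.L i).toLinearMap
      (summandInclusion D.R i).toLinearMap f.toLinearMap
      (χ.toLin ∘ₗ D.U.symm.toLinearMap ∘ₗ
        (summandInclusion (fun i => D.L i ⊗[ℂ] D.R i) i).toLinearMap) hf (D.U x i)).trans ?_
    refine Finset.sum_congr rfl fun k _ => ?_
    have hE' : E ⟨i, k⟩ x = D.U.symm (summandInclusion (fun i => D.L i ⊗[ℂ] D.R i) i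
          (((innerₛₗ ℂ (e i k)).smulRight (u i)).rTensor _ (D.U x i))) := by
      rw [← hUE ⟨i, k⟩ x, LinearIsometryEquiv.symm_apply_apply]
    rw [hE']
    rfl

end BlockDecomposition

/-! ### The commutant and irreducible subspaces -/

namespace VNAlg

variable {H : Type u} [NormedAddCommGroup H] [InnerProductSpace ℂ H] [FiniteDimensional ℂ H]

/-- The commutant of `A`. -/
noncomputable abbrev commutant (A : VNAlg H) : VNAlg H :=
  StarSubalgebra.centralizer ℂ (A : Set (Module.End ℂ H))

variable {A : VNAlg H}

theorem adjoint_mem {T : Module.End ℂ H} (hT : T ∈ A) : LinearMap.adjoint T ∈ A := by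
  rw [← LinearMap.star_eq_adjoint]
  exact star_mem hT

theorem mem_commutant_iff {S : Module.End ℂ H} :
    S ∈ commutant A ↔ ∀ T ∈ A, ∀ x, T (S x) = S (T x) := by
  rw [StarSubalgebra.mem_centralizer_iff]
  refine ⟨fun h T hT x => LinearMap.congr_fun (h T hT).1 x, fun h T hT => ⟨?_, ?_⟩⟩
  · exact LinearMap.ext (h T hT)
  · exact LinearMap.ext (h _ (star_mem hT))

variable (A) in
/-- A subspace mapped into itself by all operators in `A`. -/
def IsInvariant (V : Submodule ℂ H) : Prop := ∀ T ∈ A, ∀ x ∈ V, T x ∈ V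

theorem IsInvariant.orthogonal {V : Submodule ℂ H} (hV : IsInvariant A V) : IsInvariant A Vᗮ := by
  intro T hT x hx
  rw [Submodule.mem_orthogonal] at hx ⊢
  intro y hy
  rw [← LinearMap.adjoint_inner_left]
  exact hx _ (hV _ (adjoint_mem hT) y hy)

theorem IsInvariant.inf {V W : Submodule ℂ H} (hV : IsInvariant A V) (hW : IsInvariant A W) :
    IsInvariant A (V ⊓ W) :=
  fun T hT x hx => ⟨hV T hT x hx.1, hW T hT x hx.2⟩

theorem IsInvariant.map {V : Submodule ℂ H} (hV : IsInvariant A V) {K : Module.End ℂ H}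
    (hK : K ∈ commutant A) : IsInvariant A (V.map K) := by
  rintro T hT _ ⟨x, hx, rfl⟩
  exact ⟨T x, hV T hT x hx, (mem_commutant_iff.1 hK T hT x).symm⟩

theorem isInvariant_ker {K : Module.End ℂ H} (hK : K ∈ commutant A) :
    IsInvariant A (LinearMap.ker K) := by
  intro T hT x hx
  rw [LinearMap.mem_ker] at hx ⊢
  rw [← mem_commutant_iff.1 hK T hT, hx, map_zero]

/-- The orthogonal projection onto `V`, as a linear map. -/
noncomputable def proj (V : Submodule ℂ H) : Module.End ℂ H := V.starProjection.toLinearMap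

theorem proj_mem (V : Submodule ℂ H) (x : H) : proj V x ∈ V :=
  Submodule.starProjection_apply_mem V x

theorem proj_eq_self {V : Submodule ℂ H} {x : H} (hx : x ∈ V) : proj V x = x :=
  Submodule.starProjection_eq_self_iff.2 hx

theorem adjoint_proj (V : Submodule ℂ H) : LinearMap.adjoint (proj V) = proj V :=
  ((LinearMap.eq_adjoint_iff _ _).2 (Submodule.inner_starProjection_left_eq_right V)).symm

theorem IsInvariant.proj_mem_commutant {V : Submodule ℂ H} (hV : IsInvariant A V) :
    proj V ∈ commutant A := by
  rw [mem_commutant_iff]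
  intro T hT x
  refine (Submodule.eq_starProjection_of_mem_orthogonal (hV T hT _ (proj_mem V x)) ?_).symm
  rw [← map_sub]
  exact hV.orthogonal T hT _ (Submodule.sub_starProjection_mem_orthogonal x)

/-- The double commutant theorem. `H` is a semisimple `A`-module because orthogonal complements of
submodules are submodules, so that the Jacobson density theorem applies. -/
theorem mem_of_forall_commute {T : Module.End ℂ H}
    (hT : ∀ S ∈ commutant A, ∀ x, T (S x) = S (T x)) : T ∈ A := by
  classical
  have hss : IsSemisimpleModule A.toSubalgebra H := by
    refine { exists_isCompl := fun V => ?_ }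
    let V' : Submodule ℂ H := V.restrictScalars ℂ
    have hV' : IsInvariant A V' := fun S hS x hx => V.smul_mem (⟨S, hS⟩ : A.toSubalgebra) hx
    let W : Submodule A.toSubalgebra H :=
      { V'ᗮ with smul_mem' := fun S x hx => hV'.orthogonal S.1 S.2 x hx }
    refine ⟨W, ?_, ?_⟩
    · rw [Submodule.disjoint_def]
      exact fun x hx hx' => Submodule.disjoint_def.1 V'.orthogonal_disjoint x hx hx'
    · rw [codisjoint_iff, Submodule.eq_top_iff']
      intro x
      have : x = V'.starProjection x + (x - V'.starProjection x) := by abel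
      rw [this]
      exact Submodule.add_mem_sup (Submodule.starProjection_apply_mem V' x)
        (Submodule.sub_starProjection_mem_orthogonal x)
  let f : Module.End (Module.End A.toSubalgebra H) H :=
    { toFun := T
      map_add' := map_add T
      map_smul' := fun S x => by
        let S' : Module.End ℂ H := S.restrictScalars ℂ
        have : S' ∈ commutant A := mem_commutant_iff.2 fun R hR y =>
          (S.map_smul (⟨R, hR⟩ : A.toSubalgebra) y).symm
        exact hT S' this x }
  let b := Module.finBasis ℂ H
  obtain ⟨r, hr⟩ := jacobson_density (R := A.toSubalgebra) f (Finset.univ.image b)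
  have : T = r.1 := b.ext fun i => hr (b i) (Finset.mem_image_of_mem b (Finset.mem_univ i))
  rw [this]
  exact r.2

variable (A) in
/-- A nonzero invariant subspace with no invariant subspaces other than `⊥` and itself. -/
structure IsIrreducible (V : Submodule ℂ H) : Prop where
  ne_bot : V ≠ ⊥
  isInvariant : IsInvariant A V
  eq_bot_or_eq : ∀ W ≤ V, IsInvariant A W → W = ⊥ ∨ W = V

theorem IsInvariant.exists_isIrreducible_le {W : Submodule ℂ H} (hW : IsInvariant A W)
    (h0 : W ≠ ⊥) : ∃ V ≤ W, IsIrreducible A V := by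
  obtain ⟨V, ⟨hV₁, hV₂, hV₃⟩, hmin⟩ := exists_minimal_of_wellFoundedLT
    (fun V : Submodule ℂ H => V ≠ ⊥ ∧ IsInvariant A V ∧ V ≤ W) ⟨W, h0, hW, le_rfl⟩
  refine ⟨V, hV₃, hV₁, hV₂, fun U hU hUinv => or_iff_not_imp_left.2 fun hU0 => ?_⟩
  exact le_antisymm hU (hmin ⟨hU0, hUinv, hU.trans hV₃⟩ hU)

open scoped Classical in
/-- Every invariant subspace is a finite orthogonal sum of irreducible ones. -/
theorem IsInvariant.exists_finset_isIrreducible {W : Submodule ℂ H} (hW : IsInvariant A W) :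
    ∃ s : Finset (Submodule ℂ H), (∀ V ∈ s, IsIrreducible A V) ∧
      (s : Set (Submodule ℂ H)).Pairwise (fun V V' => V ⟂ V') ∧ s.sup id = W := by
  induction W using WellFoundedLT.induction with
  | ind W ih =>
    by_cases h0 : W = ⊥
    · exact ⟨∅, by simp, by simp, by simp [h0]⟩
    obtain ⟨V, hVW, hV⟩ := hW.exists_isIrreducible_le h0
    have hlt : Vᗮ ⊓ W < W := by
      refine lt_of_le_of_ne inf_le_right fun h => hV.ne_bot ?_
      have : V ≤ Vᗮ := hVW.trans (inf_eq_right.1 h)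
      rw [eq_bot_iff, ← Submodule.inf_orthogonal_eq_bot V]
      exact le_inf le_rfl this
    obtain ⟨s, hs₁, hs₂, hs₃⟩ := ih _ hlt (hV.isInvariant.orthogonal.inf hW)
    have hperp : ∀ V' ∈ s, V ⟂ V' := fun V' hV' =>
      (Submodule.isOrtho_iff_le.2 (by
        have : V' ≤ Vᗮ ⊓ W := hs₃ ▸ Finset.le_sup (f := id) hV'
        exact this.trans inf_le_left) : V' ⟂ V).symm
    refine ⟨insert V s, ?_, ?_, ?_⟩
    · intro V' hV'
      rcases Finset.mem_insert.1 hV' with rfl | h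
      · exact hV
      · exact hs₁ V' h
    · rw [Finset.coe_insert]
      exact Set.pairwise_insert.2 ⟨hs₂, fun V' hV' _ => ⟨hperp V' hV', (hperp V' hV').symm⟩⟩
    · rw [Finset.sup_insert, hs₃, id]
      exact Submodule.sup_orthogonal_inf_of_hasOrthogonalProjection hVW

/-! ### Schur's lemma -/

theorem IsIrreducible.exists_eq_smul {V : Submodule ℂ H} (hV : IsIrreducible A V)
    {K : Module.End ℂ H} (hK : K ∈ commutant A) (hKV : ∀ x ∈ V, K x ∈ V) :
    ∃ c : ℂ, ∀ x ∈ V, K x = c • x := by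
  have : Nontrivial V := Submodule.nontrivial_iff_ne_bot.2 hV.ne_bot
  obtain ⟨c, hc⟩ := Module.End.exists_eigenvalue (K.restrict hKV)
  obtain ⟨v, hv⟩ := hc.exists_hasEigenvector
  have hKc : K - algebraMap ℂ _ c ∈ commutant A := sub_mem hK (algebraMap_mem _ c)
  have hinv := (isInvariant_ker hKc).inf hV.isInvariant
  have hv' : K v = c • (v : H) := congrArg Subtype.val hv.apply_eq_smul
  refine ⟨c, fun x hx => ?_⟩
  rcases hV.eq_bot_or_eq _ inf_le_right hinv with h | h
  · have hmem : (v : H) ∈ LinearMap.ker (K - algebraMap ℂ _ c) ⊓ V :=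
      ⟨by simp [hv', Module.algebraMap_end_apply], v.2⟩
    rw [h, Submodule.mem_bot] at hmem
    exact absurd (Subtype.ext hmem) hv.2
  · rw [← h] at hx
    have := LinearMap.mem_ker.1 hx.1
    rw [LinearMap.sub_apply, Module.algebraMap_end_apply, sub_eq_zero] at this
    exact this

variable (A) in
/-- Unitary equivalence of invariant subspaces as representations of `A`: some operator in the
commutant restricts to an isometry of `V` onto `W`. -/
def Equivalent (V W : Submodule ℂ H) : Prop :=
  ∃ K ∈ commutant A, (∀ x ∈ V, ‖K x‖ = ‖x‖) ∧ V.map K = W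

theorem Equivalent.refl (V : Submodule ℂ H) : Equivalent A V V :=
  ⟨1, one_mem _, fun _ _ => rfl, Submodule.map_id V⟩

theorem Equivalent.trans {V W U : Submodule ℂ H} (h₁ : Equivalent A V W)
    (h₂ : Equivalent A W U) : Equivalent A V U := by
  obtain ⟨K, hK, hKn, rfl⟩ := h₁
  obtain ⟨K', hK', hKn', rfl⟩ := h₂
  refine ⟨K' * K, mul_mem hK' hK, fun x hx => ?_, Submodule.map_comp K K' V⟩
  rw [Module.End.mul_apply, hKn' _ (Submodule.mem_map_of_mem hx), hKn x hx]

/-- If `K` is isometric on `V`, then `(K p)† (K p) = p` for the projection `p` onto `V`. -/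
theorem adjoint_comp_proj_of_norm {V : Submodule ℂ H} {K : Module.End ℂ H}
    (hK : ∀ x ∈ V, ‖K x‖ = ‖x‖) :
    LinearMap.adjoint (K ∘ₗ proj V) ∘ₗ (K ∘ₗ proj V) = proj V := by
  let k : V →ₗᵢ[ℂ] H := ⟨K.domRestrict V, fun x => hK x x.2⟩
  refine LinearMap.ext fun x => ext_inner_left ℂ fun y => ?_
  rw [LinearMap.comp_apply, LinearMap.adjoint_inner_right]
  have := k.inner_map_map ⟨proj V y, proj_mem V y⟩ ⟨proj V x, proj_mem V x⟩
  refine this.trans ?_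
  change inner ℂ (proj V y) (proj V x) = _
  rw [← LinearMap.adjoint_inner_right, adjoint_proj, proj_eq_self (proj_mem V x)]

theorem Equivalent.symm {V W : Submodule ℂ H} (hV : IsInvariant A V) (h : Equivalent A V W) :
    Equivalent A W V := by
  obtain ⟨K, hK, hKn, rfl⟩ := h
  have hadj := adjoint_comp_proj_of_norm hKn
  have key (x : H) (hx : x ∈ V) : LinearMap.adjoint (K ∘ₗ proj V) (K x) = x := by
    have := LinearMap.congr_fun hadj x
    rwa [LinearMap.comp_apply, LinearMap.comp_apply, proj_eq_self hx] at this
  refine ⟨LinearMap.adjoint (K ∘ₗ proj V), adjoint_mem (mul_mem hK hV.proj_mem_commutant), ?_, ?_⟩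
  · rintro _ ⟨x, hx, rfl⟩
    rw [key x hx, hKn x hx]
  · ext x
    constructor
    · rintro ⟨_, ⟨y, hy, rfl⟩, rfl⟩
      rwa [key y hy]
    · exact fun hx => ⟨K x, Submodule.mem_map_of_mem hx, key x hx⟩

/-- An operator in the commutant that is nonzero between two irreducible subspaces makes them
unitarily equivalent: `K† K` is a positive scalar on `V`, so a multiple of `K` is isometric. -/
theorem IsIrreducible.equivalent {V W : Submodule ℂ H} (hV : IsIrreducible A V)
    (hW : IsIrreducible A W) {K : Module.End ℂ H} (hK : K ∈ commutant A)
    (hKVW : ∀ x ∈ V, K x ∈ W) {v : H} (hv : v ∈ V) (hKv : K v ≠ 0) : Equivalent A V W := by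
  have hp := hV.isInvariant.proj_mem_commutant
  have hKp : K ∘ₗ proj V ∈ commutant A := mul_mem hK hp
  obtain ⟨c, hc⟩ := hV.exists_eq_smul (K := LinearMap.adjoint (K ∘ₗ proj V) ∘ₗ (K ∘ₗ proj V))
    (mul_mem (adjoint_mem hKp) hKp) fun x _ => by
      rw [LinearMap.adjoint_comp, adjoint_proj]
      exact proj_mem V _
  have hc' (x : H) (hx : x ∈ V) : ((‖K x‖ : ℂ)) ^ 2 = c * (‖x‖ : ℂ) ^ 2 := by
    have h := congrArg (inner ℂ x) (hc x hx)
    rw [LinearMap.comp_apply, LinearMap.adjoint_inner_right, LinearMap.comp_apply,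
      proj_eq_self hx, inner_smul_right, inner_self_eq_norm_sq_to_K,
      inner_self_eq_norm_sq_to_K] at h
    exact h
  have hv0 : ‖v‖ ≠ 0 := fun h => hKv (by rw [norm_eq_zero.1 h, map_zero])
  obtain ⟨r, hr⟩ : ∃ r : ℝ, r = ‖K v‖ / ‖v‖ := ⟨_, rfl⟩
  have hr0 : 0 < r := by rw [hr]; positivity
  have hcr : c = (r : ℂ) ^ 2 := by
    have hv0' : (‖v‖ : ℂ) ≠ 0 := by exact_mod_cast hv0
    rw [hr]
    push_cast
    rw [div_pow, hc' v hv]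
    field_simp
  have hnorm (x : H) (hx : x ∈ V) : ‖K x‖ = r * ‖x‖ := by
    have := hc' x hx
    rw [hcr, ← mul_pow] at this
    have : ‖K x‖ ^ 2 = (r * ‖x‖) ^ 2 := by exact_mod_cast this
    exact (pow_left_inj₀ (norm_nonneg _) (by positivity) two_ne_zero).1 this
  have hK' : ((r⁻¹ : ℝ) : ℂ) • K ∈ commutant A := (commutant A).smul_mem hK _
  refine ⟨((r⁻¹ : ℝ) : ℂ) • K, hK', fun x hx => ?_, ?_⟩
  · rw [LinearMap.smul_apply, norm_smul, hnorm x hx, Complex.norm_real, Real.norm_of_nonneg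
      (inv_nonneg.2 hr0.le), inv_mul_cancel_left₀ hr0.ne']
  · refine (hW.eq_bot_or_eq _ ?_ (hV.isInvariant.map hK')).resolve_left fun h => hKv ?_
    · rintro _ ⟨x, hx, rfl⟩
      exact W.smul_mem _ (hKVW x hx)
    · have h' : (((r⁻¹ : ℝ) : ℂ) • K) v ∈ V.map (((r⁻¹ : ℝ) : ℂ) • K) :=
        Submodule.mem_map_of_mem hv
      rw [h, Submodule.mem_bot, LinearMap.smul_apply, smul_eq_zero] at h'
      exact h'.resolve_left (by exact_mod_cast (inv_pos.2 hr0).ne')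

end VNAlg

/-! ### Representation unitaries exist -/

section

variable {H : Type u} [NormedAddCommGroup H] [InnerProductSpace ℂ H]
  {ι : Type u} {L : ι → Type u} [∀ i, NormedAddCommGroup (L i)]
  [∀ i, InnerProductSpace ℂ (L i)] {κ : ι → Type u} [∀ i, Fintype (κ i)]

/-- The map `x ↦ ⨁ i, ∑ s, q i s x ⊗ δ s` assembled from maps `q i s : H → L i`. -/
noncomputable def coordinateMap (q : ∀ i, κ i → H →ₗ[ℂ] L i) :
    H →ₗ[ℂ] PiLp 2 fun i => L i ⊗[ℂ] EuclideanSpace ℂ (κ i) where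
  toFun x := WithLp.toLp 2 fun i => ∑ s, q i s x ⊗ₜ EuclideanSpace.basisFun (κ i) ℂ s
  map_add' x y := by
    refine PiLp.ext fun i => ?_
    simp [TensorProduct.add_tmul, Finset.sum_add_distrib]
  map_smul' c x := by
    refine PiLp.ext fun i => ?_
    simp [← TensorProduct.smul_tmul', Finset.smul_sum]

theorem coordinateMap_apply (q : ∀ i, κ i → H →ₗ[ℂ] L i) (x : H) (i : ι) :
    coordinateMap q x i = ∑ s, q i s x ⊗ₜ EuclideanSpace.basisFun (κ i) ℂ s := rfl

theorem sum_tmul_basisFun_injective {X κ : Type*} [AddCommGroup X] [Module ℂ X] [Fintype κ]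
    {v w : κ → X} (h : ∑ s, v s ⊗ₜ[ℂ] EuclideanSpace.basisFun κ ℂ s =
      ∑ s, w s ⊗ₜ[ℂ] EuclideanSpace.basisFun κ ℂ s) : v = w := by
  classical
  let b := (EuclideanSpace.basisFun κ ℂ).toBasis
  have hb (v : κ → X) (t : κ) : TensorProduct.slice X (b.coord t)
      (∑ s, v s ⊗ₜ[ℂ] EuclideanSpace.basisFun κ ℂ s) = v t := by
    have hbs (s : κ) : EuclideanSpace.basisFun κ ℂ s = b s := by simp [b]
    simp only [hbs, map_sum, TensorProduct.slice_tmul, Module.Basis.coord_apply,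
      Module.Basis.repr_self, Finsupp.single_apply, ite_smul, one_smul, zero_smul]
    simp
  funext t
  rw [← hb v t, h, hb w t]

variable [Fintype ι] [FiniteDimensional ℂ H] [∀ i, FiniteDimensional ℂ (L i)]

/-- If `∑ (q i s)† q i s = 1`, then the coordinate map is isometric. -/
theorem inner_coordinateMap (q : ∀ i, κ i → H →ₗ[ℂ] L i)
    (hsum : ∀ x, ∑ i, ∑ s, LinearMap.adjoint (q i s) (q i s x) = x) (x y : H) :
    inner ℂ (coordinateMap q x) (coordinateMap q y) = inner ℂ x y := by
  classical
  conv_rhs => rw [← hsum y]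
  rw [PiLp.inner_apply, inner_sum]
  refine Finset.sum_congr rfl fun i _ => ?_
  rw [coordinateMap_apply, coordinateMap_apply, sum_inner, inner_sum]
  refine Finset.sum_congr rfl fun s _ => ?_
  rw [inner_sum, Finset.sum_eq_single s]
  · rw [TensorProduct.inner_tmul, LinearMap.adjoint_inner_right, OrthonormalBasis.inner_eq_one,
      mul_one]
  · intro t _ ht
    rw [TensorProduct.inner_tmul, OrthonormalBasis.inner_eq_zero _ ht.symm, mul_zero]
  · simp

/-- If the `q i s` are coisometries with mutually orthogonal supports, then the coordinate map is
surjective. -/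
theorem coordinateMap_surjective (q : ∀ i, κ i → H →ₗ[ℂ] L i)
    (h₁ : ∀ i s l, q i s (LinearMap.adjoint (q i s) l) = l)
    (h₂ : ∀ i s t l, s ≠ t → q i s (LinearMap.adjoint (q i t) l) = 0)
    (h₃ : ∀ i j s t l, i ≠ j → q i s (LinearMap.adjoint (q j t) l) = 0) :
    Function.Surjective (coordinateMap q) := by
  classical
  intro y
  let b (i : ι) := (EuclideanSpace.basisFun (κ i) ℂ).toBasis
  let v (i : ι) (s : κ i) : L i := TensorProduct.slice (L i) ((b i).coord s) (y i)
  refine ⟨∑ i, ∑ s, LinearMap.adjoint (q i s) (v i s), PiLp.ext fun i => ?_⟩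
  rw [coordinateMap_apply, ← TensorProduct.sum_slice_tmul (b i) (y i)]
  refine Finset.sum_congr rfl fun s _ => ?_
  have hq : q i s (∑ i, ∑ s, LinearMap.adjoint (q i s) (v i s)) = v i s := by
    rw [map_sum, Finset.sum_eq_single i, map_sum, Finset.sum_eq_single s, h₁]
    · exact fun t _ ht => h₂ i s t _ ht.symm
    · simp
    · intro j _ hj
      rw [map_sum]
      exact Finset.sum_eq_zero fun t _ => h₃ i j s t _ hj.symm
    · simp
  rw [hq]
  simp [b, v]

/-- The block decomposition with multiplicity spaces `ℂ ^ κ i` given by coisometries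
`q i s : H → L i` with mutually orthogonal supports spanning `H`. -/
noncomputable def BlockDecomposition.ofCoisometries [∀ i, Nontrivial (L i)] [∀ i, Nonempty (κ i)]
    (q : ∀ i, κ i → H →ₗ[ℂ] L i)
    (hsum : ∀ x, ∑ i, ∑ s, LinearMap.adjoint (q i s) (q i s x) = x)
    (h₁ : ∀ i s l, q i s (LinearMap.adjoint (q i s) l) = l)
    (h₂ : ∀ i s t l, s ≠ t → q i s (LinearMap.adjoint (q i t) l) = 0)
    (h₃ : ∀ i j s t l, i ≠ j → q i s (LinearMap.adjoint (q j t) l) = 0) :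
    BlockDecomposition H where
  ι := ι
  L := L
  R i := EuclideanSpace ℂ (κ i)
  U := LinearIsometryEquiv.ofSurjective
    ((coordinateMap q).isometryOfInner (inner_coordinateMap q hsum))
    (coordinateMap_surjective q h₁ h₂ h₃)

end

namespace VNAlg

variable {H : Type u} [NormedAddCommGroup H] [InnerProductSpace ℂ H] [FiniteDimensional ℂ H]

/-- Block decompositions built from pairwise inequivalent irreducible subspaces `L i` and
coisometries `q i s : H → L i` in the commutant represent `A`. An operator `⨁ i, a i ⊗ 1` commutes
with every `S` in the commutant: by Schur's lemma `q j t S (q i s)†` is a scalar for `i = j`, and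
vanishes otherwise. So the double commutant theorem applies. -/
theorem represents_ofCoisometries {A : VNAlg H} {ι : Type u} [Fintype ι]
    {L : ι → Submodule ℂ H} (hL : ∀ i, IsIrreducible A (L i))
    (hne : ∀ i j, Equivalent A (L i) (L j) → i = j)
    {κ : ι → Type u} [∀ i, Fintype (κ i)] [∀ i, Nonempty (κ i)] [∀ i, Nontrivial (L i)]
    (q : ∀ i, κ i → H →ₗ[ℂ] L i)
    (hq : ∀ i s, (L i).subtype ∘ₗ q i s ∈ commutant A)
    (hsum : ∀ x, ∑ i, ∑ s, LinearMap.adjoint (q i s) (q i s x) = x)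
    (h₁ : ∀ i s l, q i s (LinearMap.adjoint (q i s) l) = l)
    (h₂ : ∀ i s t l, s ≠ t → q i s (LinearMap.adjoint (q i t) l) = 0)
    (h₃ : ∀ i j s t l, i ≠ j → q i s (LinearMap.adjoint (q j t) l) = 0) :
    (BlockDecomposition.ofCoisometries q hsum h₁ h₂ h₃).Represents A := by
  intro T
  change T ∈ A ↔ ∃ a : ∀ i, Module.End ℂ (L i), ∀ (x : H) (i : ι),
    coordinateMap q (T x) i = (a i).rTensor (EuclideanSpace ℂ (κ i)) (coordinateMap q x i)
  have hcoord (a : ∀ i, Module.End ℂ (L i)) (x : H) (i : ι) :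
      (a i).rTensor (EuclideanSpace ℂ (κ i)) (coordinateMap q x i) =
        ∑ s, a i (q i s x) ⊗ₜ EuclideanSpace.basisFun (κ i) ℂ s := by
    rw [coordinateMap_apply, map_sum]
    rfl
  constructor
  · intro hT
    let a (i : ι) : Module.End ℂ (L i) := T.restrict ((hL i).isInvariant T hT)
    refine ⟨a, fun x i => ?_⟩
    rw [hcoord a, coordinateMap_apply]
    refine Finset.sum_congr rfl fun s _ => ?_
    congr 1
    exact Subtype.ext (mem_commutant_iff.1 (hq i s) T hT x).symm
  · rintro ⟨a, ha⟩
    have haq (x : H) (i : ι) (s : κ i) : q i s (T x) = a i (q i s x) := by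
      have := ha x i
      rw [hcoord, coordinateMap_apply] at this
      exact congrFun (sum_tmul_basisFun_injective this) s
    refine mem_of_forall_commute fun S hS x => ?_
    -- The matrix entries of `S` intertwine the `a i`.
    have hG (i j : ι) (s : κ i) (t : κ j) (l : L i) :
        q j t (S (LinearMap.adjoint (q i s) (a i l))) =
          a j (q j t (S (LinearMap.adjoint (q i s) l))) := by
      let G : Module.End ℂ H := ((L j).subtype ∘ₗ q j t) * S *
        LinearMap.adjoint ((L i).subtype ∘ₗ q i s)
      have hGmem : G ∈ commutant A := mul_mem (mul_mem (hq j t) hS) (adjoint_mem (hq i s))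
      have hGL (x : H) : G x ∈ L j := Subtype.property _
      have hGl (l : L i) : G l = (q j t (S (LinearMap.adjoint (q i s) l)) : H) := by
        have : LinearMap.adjoint ((L i).subtype ∘ₗ q i s) (l : H) =
            LinearMap.adjoint (q i s) l := by
          refine ext_inner_left ℂ fun y => ?_
          rw [LinearMap.adjoint_inner_right, LinearMap.adjoint_inner_right]
          rfl
        rw [← this]
        rfl
      by_cases hij : i = j
      · subst hij
        obtain ⟨c, hc⟩ := (hL i).exists_eq_smul hGmem fun x _ => hGL x
        have hc' (l : L i) : q i t (S (LinearMap.adjoint (q i s) l)) = c • l :=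
          Subtype.ext ((hGl l).symm.trans (hc l l.2))
        rw [hc', hc', map_smul]
      · have h0 (l : L i) : q j t (S (LinearMap.adjoint (q i s) l)) = 0 := by
          by_contra hl
          refine hij (hne i j ((hL i).equivalent (hL j) hGmem (fun x _ => hGL x) l.2 ?_))
          rw [hGl]
          exact fun h => hl (Subtype.ext h)
        rw [h0, h0, map_zero]
    have hexp (y : H) (j : ι) (t : κ j) : q j t (S y) =
        ∑ i, ∑ s, q j t (S (LinearMap.adjoint (q i s) (q i s y))) := by
      conv_lhs => rw [← hsum y]
      simp only [map_sum]
    have hjt (j : ι) (t : κ j) : q j t (T (S x)) = q j t (S (T x)) := by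
      rw [haq, hexp, hexp, map_sum]
      refine Finset.sum_congr rfl fun i _ => ?_
      rw [map_sum]
      refine Finset.sum_congr rfl fun s _ => ?_
      rw [haq, hG]
    rw [← hsum (T (S x)), ← hsum (S (T x))]
    simp only [hjt]

/-- Every von Neumann algebra has a representation unitary. The multiplicity space of an
irreducible subspace is `ℂ ^ n` for the number `n` of its copies in an orthogonal decomposition
of `H` into irreducible subspaces. -/
theorem exists_represents (A : VNAlg H) : ∃ D : BlockDecomposition H, D.Represents A := by
  classical
  obtain ⟨σ, hirr, hperp, hsup⟩ := IsInvariant.exists_finset_isIrreducible (A := A) (W := ⊤)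
    fun _ _ _ _ => trivial
  let eqv : Setoid σ :=
    { r := fun V W => Equivalent A (V : Submodule ℂ H) W
      iseqv := ⟨fun V => Equivalent.refl _, fun {V W} h => h.symm (hirr V V.2).isInvariant,
        fun h h' => h.trans h'⟩ }
  let ι := Quotient eqv
  let L (i : ι) : Submodule ℂ H := (i.out : σ)
  let κ (i : ι) : Type u := {V : σ // (⟦V⟧ : ι) = i}
  have hL (i : ι) : IsIrreducible A (L i) := hirr _ i.out.2
  have hκ (i : ι) : Nonempty (κ i) := ⟨⟨i.out, i.out_eq⟩⟩
  have hLn (i : ι) : Nontrivial (L i) := Submodule.nontrivial_iff_ne_bot.2 (hL i).ne_bot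
  have hKex (i : ι) (V : κ i) : Equivalent A (V.1 : Submodule ℂ H) (L i) :=
    Quotient.exact (V.2.trans i.out_eq.symm)
  choose K hK hKn hKm using hKex
  let q (i : ι) (V : κ i) : H →ₗ[ℂ] L i := (K i V ∘ₗ proj V.1.1).codRestrict (L i) fun x => by
    rw [← hKm i V]
    exact Submodule.mem_map_of_mem (proj_mem _ x)
  have hqK (i : ι) (V : κ i) : (L i).subtype ∘ₗ q i V = K i V ∘ₗ proj V.1.1 := rfl
  have hadj (i : ι) (V : κ i) (l : L i) :
      LinearMap.adjoint (q i V) l = LinearMap.adjoint (K i V ∘ₗ proj V.1.1) (l : H) := by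
    refine ext_inner_left ℂ fun y => ?_
    rw [LinearMap.adjoint_inner_right, LinearMap.adjoint_inner_right]
    rfl
  have hpinv (V : σ) : proj V.1 ∈ commutant A := (hirr V V.2).isInvariant.proj_mem_commutant
  have hqq (i : ι) (V : κ i) (x : H) : LinearMap.adjoint (q i V) (q i V x) = proj V.1.1 x := by
    rw [hadj]
    exact LinearMap.congr_fun (adjoint_comp_proj_of_norm (hKn i V)) x
  have hrange (i : ι) (V : κ i) (l : L i) : LinearMap.adjoint (q i V) l ∈ V.1.1 := by
    rw [hadj, LinearMap.adjoint_comp, adjoint_proj]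
    exact proj_mem _ _
  have hzero (i : ι) (V : κ i) (W : σ) (hVW : V.1 ≠ W) (x : H) (hx : x ∈ W.1) : q i V x = 0 := by
    refine Subtype.ext ?_
    change K i V (proj V.1.1 x) = 0
    have : proj V.1.1 x = 0 := by
      refine (Submodule.starProjection_apply_eq_zero_iff _).2 ?_
      exact (hperp W.2 V.1.2 fun h => hVW (Subtype.ext h.symm)).le hx
    rw [this, map_zero]
  refine ⟨_, represents_ofCoisometries (A := A) (L := L) hL ?_ q
    (fun i V => mul_mem (hK i V) (hpinv V.1)) ?_ ?_ ?_ ?_⟩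
  · exact fun i j h => Quotient.out_equiv_out.1 h
  · intro x
    simp only [hqq]
    have hfam : OrthogonalFamily ℂ (fun V : σ => V.1) fun V => V.1.subtypeₗᵢ :=
      OrthogonalFamily.of_pairwise fun V W hVW =>
        hperp V.2 W.2 fun h => hVW (Subtype.ext h)
    have hx : x ∈ ⨆ V : σ, V.1 := by
      have : ⨆ V : σ, V.1 = ⊤ := by
        rw [← hsup, Finset.sup_eq_iSup, iSup_subtype]
        rfl
      rw [this]
      trivial
    rw [← Fintype.sum_sigma' (fun i (V : κ i) => proj V.1.1 x)]
    refine Eq.trans ?_ (hfam.sum_projection_of_mem_iSup x hx)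
    exact Fintype.sum_equiv (Equiv.sigmaFiberEquiv (fun V : σ => (⟦V⟧ : ι))) _ _ fun _ => rfl
  · intro i V l
    obtain ⟨y, hy, hyl⟩ : (l : H) ∈ (V.1.1).map (K i V) := (hKm i V).symm ▸ l.2
    have hl : l = q i V y := Subtype.ext (by
      rw [← hyl]
      exact congrArg (K i V) (proj_eq_self hy).symm)
    rw [hl, hqq, proj_eq_self hy]
  · intro i V W l hVW
    exact hzero i V W.1 (fun h => hVW (Subtype.ext h)) _ (hrange i W l)
  · intro i j V W l hij
    exact hzero i V W.1 (fun h => hij (by rw [← V.2, ← W.2, h])) _ (hrange j W l)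

end VNAlg

/-! ### The equivalence of preorders -/

theorem IsCanonicalFor.stLocL_eq {H : Type u} [NormedAddCommGroup H] [InnerProductSpace ℂ H]
    [FiniteDimensional ℂ H] {A : VNAlg H} {χ : SplittingMap H} (h : IsCanonicalFor A χ) :
    χ.stLocL = A := by
  obtain ⟨D, hD, rfl⟩ := h
  exact hD.stLocL_splittingMap

theorem IsCanonicalFor.isBalanced {H : Type u} [NormedAddCommGroup H] [InnerProductSpace ℂ H]
    [FiniteDimensional ℂ H] {A : VNAlg H} {χ : SplittingMap H} (h : IsCanonicalFor A χ) :
    χ.IsBalanced := by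
  obtain ⟨D, hD, rfl⟩ := h
  exact hD.isBalanced

theorem IsCanonicalFor.le {H : Type u} [NormedAddCommGroup H] [InnerProductSpace ℂ H]
    [FiniteDimensional ℂ H] [Nontrivial H] {A : VNAlg H} {ζ χ : SplittingMap H}
    (h : IsCanonicalFor A ζ) (hχ : A ≤ χ.stLocL) : ζ ≤ χ := by
  obtain ⟨D, hD, rfl⟩ := h
  exact hD.splittingMap_le hχ

/-- A balanced splitting map is comprehended in the canonical ones for its algebra of strictly
local operators: after exchanging left and right, this is an instance of `IsCanonicalFor.le` for
the commutant. -/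
theorem SplittingMap.IsBalanced.le {H : Type u} [NormedAddCommGroup H] [InnerProductSpace ℂ H]
    [FiniteDimensional ℂ H] [Nontrivial H] {ζ χ : SplittingMap H} (hχ : χ.IsBalanced)
    (h : IsCanonicalFor χ.stLocL ζ) : χ ≤ ζ := by
  obtain ⟨D, hD, rfl⟩ := h
  rw [← flip_le_flip, ← D.splittingMap_flip]
  refine hD.flip.splittingMap_le ?_
  rw [stLocL_flip, χ.isBalanced_iff.1 hχ]

theorem mainTheorem1 {H : Type u} [NormedAddCommGroup H] [InnerProductSpace ℂ H]
    [FiniteDimensional ℂ H] [Nontrivial H] :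
    (∀ A : VNAlg H, ∃ χ : SplittingMap H, IsCanonicalFor A χ) ∧
    ∀ F : VNAlg H → SplittingMap H, (∀ A, IsCanonicalFor A (F A)) →
      Monotone F ∧
      Monotone (fun χ : SplittingMap H => χ.stLocL) ∧
      IsGreatest {C : Set (SplittingMap H) | YieldEquivalenceOn F C}
        {χ : SplittingMap H | χ.IsBalanced} := by
  refine ⟨fun A => ?_, fun F hF => ?_⟩
  · obtain ⟨D, hD⟩ := VNAlg.exists_represents A
    exact ⟨D.splittingMap, D, hD, rfl⟩
  have hmono : Monotone F := fun A A' h => (hF A).le (h.trans (hF A').stLocL_eq.ge)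
  refine ⟨hmono, SplittingMap.stLocL_mono, ?_, ?_⟩
  · refine ⟨fun A => (hF A).isBalanced, fun A A' h => hmono h,
      fun ζ χ h => SplittingMap.stLocL_mono h, fun A => ?_, fun χ => ?_⟩
    · exact ⟨(hF A).stLocL_eq.ge, (hF A).stLocL_eq.le⟩
    · exact ⟨SplittingMap.IsBalanced.le χ.2 (hF _), (hF _).le le_rfl⟩
  · rintro C ⟨_, -, -, -, hC⟩ χ hχ
    obtain ⟨h₁, h₂⟩ := hC ⟨χ, hχ⟩
    have hR : χ.stLocR = (F χ.stLocL).stLocR :=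
      le_antisymm (SplittingMap.stLocR_anti h₂) (SplittingMap.stLocR_anti h₁)
    refine χ.isBalanced_iff.2 ?_
    rw [hR, (F χ.stLocL).isBalanced_iff.1 (hF _).isBalanced, (hF _).stLocL_eq]
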